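/- Let $q\in\mathbb{C}^\times$ be not a root of unity and put $\delta=q+q^{-1}$. For $N\ge 0$ let $\mathrm{TL}_N$ be the Temperley--Lieb algebra on $N$ sites: the unital associative $\mathbb{C}$-algebra generated by $e_1,\dots,e_{N-1}$ with relations $e_i^2=\delta e_i$, $e_ie_{i\pm1}e_i=e_i$, and $e_ie_j=e_je_i$ for $|i-j|\ge 2$. For $j\in\tfrac12\mathbb{Z}_{\ge0}$ with $2j\le N$ and $2j\equiv N \pmod 2$, let $W_j[N]$ be the standard $\mathrm{TL}_N$-module: it has as basis the link states on $N$ sites with $2j$ through-lines (configurations of non-crossing arcs joining $N-2j$ of the sites in pairs, the other $2j$ sites carrying through-lines none of which is enclosed by an arc), and $e_i$ acts by stacking diagrams, each closed loop being replaced by a factor $\delta$ and the result being $0$ if two through-lines are contracted. For a $\mathrm{TL}_{N_1}$-module $M_1$ and a $\mathrm{TL}_{N_2}$-module $M_2$ (same $\delta$), let $$M_1\times_f M_2=\mathrm{TL}_{N_1+N_2}\otimes_{\mathrm{TL}_{N_1}\otimes\mathrm{TL}_{N_2}}(M_1\otimes M_2)$$ be their fusion, the left $\mathrm{TL}_{N_1+N_2}$-module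 induced along the natural homomorphism $\mathrm{TL}_{N_1}\otimes\mathrm{TL}_{N_2}\to\mathrm{TL}_{N_1+N_2}$, $e_i\otimes 1\mapsto e_i$, $1\otimes e_i\mapsto e_{N_1+i}$. Then for all $N_1,N_2\ge0$ and all $j_1,j_2\in\tfrac12\mathbb{Z}_{\ge0}$ with $2j_a\le N_a$ and $2j_a\equiv N_a\pmod 2$ ($a=1,2$) there is an isomorphism of $\mathrm{TL}_{N_1+N_2}$-modules $$W_{j_1}[N_1]\times_f W_{j_2}[N_2]\;\cong\;\bigoplus_{j=|j_1-j_2|}^{j_1+j_2}W_j[N_1+N_2],$$ where $j$ runs in integer steps. -/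

import Mathlib

open scoped TensorProduct DirectSum

noncomputable section

namespace TemperleyLieb

/-! ### The Temperley-Lieb algebra by generators and relations -/

/-- The defining relations of the Temperley-Lieb algebra on `N` sites with loop fugacity `δ`.
The generator usually called `e_{i+1}`, acting on the neighbouring sites `i` and `i + 1`
(sites are counted from `0`), is indexed by `i : Fin (N - 1)`. -/
inductive Rel (δ : ℂ) (N : ℕ) :
    FreeAlgebra ℂ (Fin (N - 1)) → FreeAlgebra ℂ (Fin (N - 1)) → Prop
  | sq (i : Fin (N - 1)) :
      Rel δ N (FreeAlgebra.ι ℂ i * FreeAlgebra.ι ℂ i) (δ • FreeAlgebra.ι ℂ i)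
  | braid (i j : Fin (N - 1)) (h : (i : ℕ) + 1 = j ∨ (j : ℕ) + 1 = i) :
      Rel δ N (FreeAlgebra.ι ℂ i * FreeAlgebra.ι ℂ j * FreeAlgebra.ι ℂ i) (FreeAlgebra.ι ℂ i)
  | comm (i j : Fin (N - 1)) (h : (i : ℕ) + 2 ≤ j ∨ (j : ℕ) + 2 ≤ i) :
      Rel δ N (FreeAlgebra.ι ℂ i * FreeAlgebra.ι ℂ j) (FreeAlgebra.ι ℂ j * FreeAlgebra.ι ℂ i)

/-- The Temperley-Lieb algebra on `N` sites with loop fugacity `δ`. -/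
def TL (δ : ℂ) (N : ℕ) : Type := RingQuot (Rel δ N)

instance (δ : ℂ) (N : ℕ) : Ring (TL δ N) := inferInstanceAs (Ring (RingQuot (Rel δ N)))

instance (δ : ℂ) (N : ℕ) : Algebra ℂ (TL δ N) :=
  inferInstanceAs (Algebra ℂ (RingQuot (Rel δ N)))

/-- The generators of the Temperley-Lieb algebra. -/
def gen (δ : ℂ) (N : ℕ) (i : Fin (N - 1)) : TL δ N :=
  RingQuot.mkAlgHom ℂ (Rel δ N) (FreeAlgebra.ι ℂ i)

theorem gen_sq (δ : ℂ) (N : ℕ) (i : Fin (N - 1)) :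
    gen δ N i * gen δ N i = δ • gen δ N i := by
  have h := RingQuot.mkAlgHom_rel ℂ (Rel.sq (δ := δ) i)
  simp only [map_mul, map_smul] at h
  exact h

theorem gen_braid (δ : ℂ) (N : ℕ) (i j : Fin (N - 1))
    (hij : (i : ℕ) + 1 = j ∨ (j : ℕ) + 1 = i) :
    gen δ N i * gen δ N j * gen δ N i = gen δ N i := by
  have h := RingQuot.mkAlgHom_rel ℂ (Rel.braid (δ := δ) i j hij)
  simp only [map_mul] at h
  exact h

theorem gen_comm (δ : ℂ) (N : ℕ) (i j : Fin (N - 1))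
    (hij : (i : ℕ) + 2 ≤ j ∨ (j : ℕ) + 2 ≤ i) :
    gen δ N i * gen δ N j = gen δ N j * gen δ N i := by
  have h := RingQuot.mkAlgHom_rel ℂ (Rel.comm (δ := δ) i j hij)
  simp only [map_mul] at h
  exact h

/-- The universal property of the presentation. -/
def lift {δ : ℂ} {N : ℕ} {B : Type*} [Ring B] [Algebra ℂ B] (f : Fin (N - 1) → B)
    (hsq : ∀ i, f i * f i = δ • f i)
    (hbraid : ∀ i j : Fin (N - 1), ((i : ℕ) + 1 = j ∨ (j : ℕ) + 1 = i) → f i * f j * f i = f i)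
    (hcomm : ∀ i j : Fin (N - 1), ((i : ℕ) + 2 ≤ j ∨ (j : ℕ) + 2 ≤ i) → f i * f j = f j * f i) :
    TL δ N →ₐ[ℂ] B :=
  RingQuot.liftAlgHom ℂ ⟨FreeAlgebra.lift ℂ f, by
    intro x y h
    cases h with
    | sq i => simpa only [map_mul, map_smul, FreeAlgebra.lift_ι_apply] using hsq i
    | braid i j h => simpa only [map_mul, FreeAlgebra.lift_ι_apply] using hbraid i j h
    | comm i j h => simpa only [map_mul, FreeAlgebra.lift_ι_apply] using hcomm i j h⟩

theorem lift_gen {δ : ℂ} {N : ℕ} {B : Type*} [Ring B] [Algebra ℂ B] (f : Fin (N - 1) → B)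
    (hsq : ∀ i, f i * f i = δ • f i)
    (hbraid : ∀ i j : Fin (N - 1), ((i : ℕ) + 1 = j ∨ (j : ℕ) + 1 = i) → f i * f j * f i = f i)
    (hcomm : ∀ i j : Fin (N - 1), ((i : ℕ) + 2 ≤ j ∨ (j : ℕ) + 2 ≤ i) → f i * f j = f j * f i)
    (i : Fin (N - 1)) : lift (δ := δ) f hsq hbraid hcomm (gen δ N i) = f i := by
  unfold lift gen
  exact (RingQuot.liftAlgHom_mkAlgHom_apply ..).trans (FreeAlgebra.lift_ι_apply f i)

theorem adjoin_gen (δ : ℂ) (N : ℕ) : Algebra.adjoin ℂ (Set.range (gen δ N)) = ⊤ := by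
  have h1 : Set.range (gen δ N) =
      (RingQuot.mkAlgHom ℂ (Rel δ N)) '' Set.range (FreeAlgebra.ι ℂ) := by
    rw [← Set.range_comp]; rfl
  rw [h1]
  refine ((RingQuot.mkAlgHom ℂ (Rel δ N)).map_adjoin _).symm.trans ?_
  rw [FreeAlgebra.adjoin_range_ι, Algebra.map_top]
  exact (AlgHom.range_eq_top _).2 (RingQuot.mkAlgHom_surjective ℂ (Rel δ N))

/-! ### Fusion -/

/-- `TL_{N₁} → TL_{N₁+N₂}`, onto the first `N₁` sites. -/
def inclLeft (δ : ℂ) (N₁ N₂ : ℕ) : TL δ N₁ →ₐ[ℂ] TL δ (N₁ + N₂) :=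
  lift (fun i => gen δ (N₁ + N₂) ⟨i, by omega⟩)
    (fun _ => gen_sq _ _ _)
    (fun i j h => gen_braid _ _ _ _ h)
    (fun i j h => gen_comm _ _ _ _ h)

/-- `TL_{N₂} → TL_{N₁+N₂}`, onto the last `N₂` sites. -/
def inclRight (δ : ℂ) (N₁ N₂ : ℕ) : TL δ N₂ →ₐ[ℂ] TL δ (N₁ + N₂) :=
  lift (fun i => gen δ (N₁ + N₂) ⟨N₁ + i, by omega⟩)
    (fun _ => gen_sq _ _ _)
    (fun i j h => gen_braid _ _ _ _ (by simp only; omega))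
    (fun i j h => gen_comm _ _ _ _ (by simp only; omega))

theorem incl_commute (δ : ℂ) (N₁ N₂ : ℕ) (a : TL δ N₁) (b : TL δ N₂) :
    Commute (inclLeft δ N₁ N₂ a) (inclRight δ N₁ N₂ b) := by
  have ha : a ∈ Algebra.adjoin ℂ (Set.range (gen δ N₁)) := by rw [adjoin_gen]; trivial
  have hb : b ∈ Algebra.adjoin ℂ (Set.range (gen δ N₂)) := by rw [adjoin_gen]; trivial
  induction ha using Algebra.adjoin_induction with
  | algebraMap r => rw [AlgHom.commutes]; exact Algebra.commute_algebraMap_left _ _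
  | add x y _ _ hx hy => rw [map_add]; exact hx.add_left hy
  | mul x y _ _ hx hy => rw [map_mul]; exact hx.mul_left hy
  | mem x hx =>
    obtain ⟨i, rfl⟩ := hx
    induction hb using Algebra.adjoin_induction with
    | algebraMap r => rw [AlgHom.commutes]; exact Algebra.commute_algebraMap_right _ _
    | add x y _ _ hx hy => rw [map_add]; exact hx.add_right hy
    | mul x y _ _ hx hy => rw [map_mul]; exact hx.mul_right hy
    | mem y hy =>
      obtain ⟨j, rfl⟩ := hy
      unfold inclLeft inclRight
      rw [lift_gen, lift_gen]
      exact gen_comm _ _ _ _ (Or.inl (by simp only; omega))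

/-- The natural map `TL_{N₁} ⊗ TL_{N₂} → TL_{N₁+N₂}` (juxtaposition). -/
def incl (δ : ℂ) (N₁ N₂ : ℕ) : TL δ N₁ ⊗[ℂ] TL δ N₂ →ₐ[ℂ] TL δ (N₁ + N₂) :=
  Algebra.TensorProduct.lift (inclLeft δ N₁ N₂) (inclRight δ N₁ N₂) (incl_commute δ N₁ N₂)

section Fusion

variable (δ : ℂ) (N₁ N₂ : ℕ)
  (M₁ : Type*) [AddCommGroup M₁] [Module ℂ M₁] [Module (TL δ N₁) M₁]
  [IsScalarTower ℂ (TL δ N₁) M₁]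
  (M₂ : Type*) [AddCommGroup M₂] [Module ℂ M₂] [Module (TL δ N₂) M₂]
  [IsScalarTower ℂ (TL δ N₂) M₂]

/-- The action of `TL_{N₁} ⊗ TL_{N₂}` on `M₁ ⊗ M₂`: `(a ⊗ b) (x ⊗ y) = a x ⊗ b y`. -/
def outerAction : TL δ N₁ ⊗[ℂ] TL δ N₂ →ₐ[ℂ] Module.End ℂ (M₁ ⊗[ℂ] M₂) :=
  Module.endTensorEndAlgHom.comp
    (Algebra.TensorProduct.map (Algebra.lsmul ℂ ℂ M₁) (Algebra.lsmul ℂ ℂ M₂))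

theorem outerAction_tmul (a : TL δ N₁) (b : TL δ N₂) (x : M₁) (y : M₂) :
    outerAction δ N₁ N₂ M₁ M₂ (a ⊗ₜ b) (x ⊗ₜ y) = (a • x) ⊗ₜ[ℂ] (b • y) := rfl

/-- The relations `x a ⊗ v = x ⊗ a v`, for `a` in `TL_{N₁} ⊗ TL_{N₂}`, of the balanced product. -/
def balancing :
    Submodule (TL δ (N₁ + N₂)) (TL δ (N₁ + N₂) ⊗[ℂ] (M₁ ⊗[ℂ] M₂)) :=
  Submodule.span (TL δ (N₁ + N₂))
    {t | ∃ (x : TL δ (N₁ + N₂)) (a : TL δ N₁ ⊗[ℂ] TL δ N₂) (v : M₁ ⊗[ℂ] M₂),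
      t = (x * incl δ N₁ N₂ a) ⊗ₜ[ℂ] v - x ⊗ₜ[ℂ] (outerAction δ N₁ N₂ M₁ M₂ a v)}

/-- The fusion `M₁ ×_f M₂`: the left `TL_{N₁+N₂}`-module induced from the
`TL_{N₁} ⊗ TL_{N₂}`-module `M₁ ⊗ M₂`, i.e. the balanced product
`TL_{N₁+N₂} ⊗_{TL_{N₁} ⊗ TL_{N₂}} (M₁ ⊗ M₂)`. -/
abbrev Fusion : Type _ :=
  (TL δ (N₁ + N₂) ⊗[ℂ] (M₁ ⊗[ℂ] M₂)) ⧸ balancing δ N₁ N₂ M₁ M₂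

end Fusion

/-! ### Link states and standard modules -/

/-- A link state on `N` sites with `k` through-lines: the sites are joined in pairs by
non-crossing arcs, the `k` remaining sites (the fixed points of `partner`) carry through-lines,
and no through-line is enclosed by an arc. -/
@[ext]
structure LinkState (N k : ℕ) where
  partner : Fin N → Fin N
  invol : ∀ a, partner (partner a) = a
  noncrossing : ∀ a b, a < b → b < partner a → ¬ partner a < partner b
  uncovered : ∀ a b, a < b → b < partner a → partner b ≠ b
  card_through : (Finset.univ.filter fun a => partner a = a).card = k

/-- Stacking the diagram of a generator at the sites `p`, `q` on a pairing `f`: the ends that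
were attached to `p` and `q` get connected with each other (if one of them was a through-line,
the other becomes one), and `p`, `q` are joined by an arc. -/
def stack {N : ℕ} (f : Fin N → Fin N) (p q x : Fin N) : Fin N :=
  if x = p then q
  else if x = q then p
  else if f x = p then (if f q = q then x else f q)
  else if f x = q then (if f p = p then x else f p)
  else f x

theorem stack_invol {N : ℕ} {f : Fin N → Fin N} (hf : ∀ a, f (f a) = a) {p q : Fin N}
    (hpq : p ≠ q) (a : Fin N) : stack f p q (stack f p q a) = a := by
  have h1 := hf a
  have h2 := hf p
  have h3 := hf q
  unfold stack
  grind

theorem stack_card {N : ℕ} {f : Fin N → Fin N} (hf : ∀ a, f (f a) = a) {p q : Fin N}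
    (hpq : p ≠ q) (h : ¬ (f p = p ∧ f q = q)) :
    (Finset.univ.filter fun a => stack f p q a = a).card =
      (Finset.univ.filter fun a => f a = a).card := by
  have h2 := hf p
  have h3 := hf q
  by_cases hp : f p = p
  · have hq : f q ≠ q := fun hq => h ⟨hp, hq⟩
    have e : (Finset.univ.filter fun a => stack f p q a = a) =
        insert (f q) ((Finset.univ.filter fun a => f a = a).erase p) := by
      ext x
      have h1 := hf x
      simp only [Finset.mem_filter, Finset.mem_univ, true_and, Finset.mem_insert,
        Finset.mem_erase]
      unfold stack
      grind
    rw [e, Finset.card_insert_of_notMem (by simp; grind), Finset.card_erase_of_mem (by simp [hp])]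
    have : 0 < (Finset.univ.filter fun a => f a = a).card := Finset.card_pos.2 ⟨p, by simp [hp]⟩
    omega
  · by_cases hq : f q = q
    · have e : (Finset.univ.filter fun a => stack f p q a = a) =
          insert (f p) ((Finset.univ.filter fun a => f a = a).erase q) := by
        ext x
        have h1 := hf x
        simp only [Finset.mem_filter, Finset.mem_univ, true_and, Finset.mem_insert,
          Finset.mem_erase]
        unfold stack
        grind
      rw [e, Finset.card_insert_of_notMem (by simp; grind),
        Finset.card_erase_of_mem (by simp [hq])]
      have : 0 < (Finset.univ.filter fun a => f a = a).card :=
        Finset.card_pos.2 ⟨q, by simp [hq]⟩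
      omega
    · congr 1
      ext x
      have h1 := hf x
      simp only [Finset.mem_filter, Finset.mem_univ, true_and]
      unfold stack
      grind

set_option maxHeartbeats 4000000 in
theorem stack_planar {N : ℕ} {f : Fin N → Fin N} (hf : ∀ a, f (f a) = a)
    (hc : ∀ a b, a < b → b < f a → ¬ f a < f b)
    (hu : ∀ a b, a < b → b < f a → f b ≠ b) {p q : Fin N}
    (hpq : (p : ℕ) + 1 = q) (a b : Fin N)
    (hab : a < b) (hb : b < stack f p q a) :
    ¬ stack f p q a < stack f p q b ∧ stack f p q b ≠ b := by
  have key : ∀ x y, x < y → y < f x → x < f y ∧ f y < f x ∧ f y ≠ y := by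
    intro x y hxy hyx
    have h1 := hc x y hxy hyx
    have h2 := hu x y hxy hyx
    have h3 : f y ≠ f x := fun e => by
      have := congrArg f e; rw [hf, hf] at this; omega
    have h4 := hc (f y) x
    have h5 := hu (f y) x
    have h6 : f y ≠ x := fun e => by rw [← e, hf] at hyx; omega
    rw [hf] at h4 h5
    omega
  have inj : ∀ x y, f x = f y → x = y := fun x y e => by
    have := congrArg f e; rwa [hf, hf] at this
  have jj : ∀ x y, f x = y → f y = x := fun x y e => by rw [← e, hf]
  have kk : ∀ x y, (x < y → y < f x → x < f y ∧ f y < f x ∧ f y ≠ y) ∧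
      (x < f y → f y < f x → x < y ∧ y < f x ∧ y ≠ f y) ∧
      (f x < y → y < x → f x < f y ∧ f y < x ∧ f y ≠ y) ∧
      (f x < f y → f y < x → f x < y ∧ y < x ∧ y ≠ f y) := by
    intro x y
    have h1 := key x y
    have h2 := key x (f y)
    have h3 := key (f x) y
    have h4 := key (f x) (f y)
    simp only [hf] at h2 h3 h4
    exact ⟨h1, h2, h3, h4⟩
  have i1 := inj a b
  have i2 := inj a p
  have i3 := inj a q
  have i4 := inj b p
  have i5 := inj b q
  have i6 := inj p q
  have j1 := jj a p
  have j2 := jj a q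
  have j3 := jj b p
  have j4 := jj b q
  have j5 := jj a b
  have j6 := jj p q
  have kab := kk a b
  have kba := kk b a
  have kap := kk a p
  have kpa := kk p a
  have kaq := kk a q
  have kqa := kk q a
  have kbp := kk b p
  have kpb := kk p b
  have kbq := kk b q
  have kqb := kk q b
  have kpq := kk p q
  have kqp := kk q p
  clear hc hu hf key inj jj kk
  unfold stack at *
  generalize f a = A at *
  generalize f b = B at *
  generalize f p = P at *
  generalize f q = Q at *
  split_ifs at hb ⊢ <;> grind

theorem stack_of_arc {N : ℕ} {f : Fin N → Fin N} (hf : ∀ a, f (f a) = a) {p q : Fin N}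
    (h : f p = q) : stack f p q = f := by
  funext x
  have h1 := hf x
  have h2 := hf p
  unfold stack
  grind

theorem stack_braid {N : ℕ} {f : Fin N → Fin N} (hf : ∀ a, f (f a) = a) {p q r s : Fin N}
    (hpq : p ≠ q) (hrs : r ≠ s) (h : p = s ∧ q ≠ r ∨ q = r ∧ p ≠ s) :
    stack (stack (stack f p q) r s) p q = stack f p q := by
  funext x
  have h1 := hf x
  have h2 := hf p
  have h3 := hf q
  have h4 := hf r
  have h5 := hf s
  unfold stack
  grind

theorem stack_comm {N : ℕ} {f : Fin N → Fin N} (hf : ∀ a, f (f a) = a) {p q r s : Fin N}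
    (hpq : p ≠ q) (hrs : r ≠ s) (h1 : p ≠ r) (h2 : p ≠ s) (h3 : q ≠ r) (h4 : q ≠ s) :
    stack (stack f p q) r s = stack (stack f r s) p q := by
  funext x
  have e1 := hf x
  have e2 := hf p
  have e3 := hf q
  have e4 := hf r
  have e5 := hf s
  unfold stack
  grind (splits := 40)

theorem stack_both_through {N : ℕ} {f : Fin N → Fin N} (hf : ∀ a, f (f a) = a) {p q r s : Fin N}
    (hpq : p ≠ q) (hrs : r ≠ s) (h1 : p ≠ r) (h2 : p ≠ s) (h3 : q ≠ r) (h4 : q ≠ s)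
    (hb : ¬ (f r = r ∧ f s = s))
    (h : stack f p q r = r ∧ stack f p q s = s) :
    stack f r s p = p ∧ stack f r s q = q := by
  have e2 := hf p
  have e3 := hf q
  have e4 := hf r
  have e5 := hf s
  unfold stack at *
  grind

theorem stack_arc_of_ne {N : ℕ} {f : Fin N → Fin N} (hf : ∀ a, f (f a) = a) {p q r s : Fin N}
    (hrs : r ≠ s) (h1 : p ≠ r) (h2 : p ≠ s) (h3 : q ≠ r) (h4 : q ≠ s)
    (hb : f r ≠ s) (h : stack f p q r = s) : stack f r s p = q := by
  have e2 := hf p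
  have e3 := hf q
  have e4 := hf r
  have e5 := hf s
  unfold stack at *
  grind

theorem stack_arc_of_eq {N : ℕ} {f : Fin N → Fin N} (hf : ∀ a, f (f a) = a) {p q r s : Fin N}
    (h1 : p ≠ r) (h2 : p ≠ s) (h3 : q ≠ r) (h4 : q ≠ s)
    (ha : f p = q) : stack f r s p = q := by
  have e2 := hf p
  unfold stack at *
  grind

namespace LinkState

variable {N k : ℕ}

/-- The first of the two neighbouring sites on which the generator with index `i` acts. -/
def fstSite (i : Fin (N - 1)) : Fin N := ⟨i, by omega⟩

/-- The second of the two neighbouring sites on which the generator with index `i` acts. -/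
def sndSite (i : Fin (N - 1)) : Fin N := ⟨i + 1, by omega⟩

theorem fst_ne_snd (i : Fin (N - 1)) : fstSite i ≠ sndSite i := by
  simp [fstSite, sndSite]

/-- Both sites of the generator carry through-lines. -/
def BothThrough (s : LinkState N k) (i : Fin (N - 1)) : Prop :=
  s.partner (fstSite i) = fstSite i ∧ s.partner (sndSite i) = sndSite i

instance (s : LinkState N k) (i : Fin (N - 1)) : Decidable (s.BothThrough i) :=
  inferInstanceAs (Decidable (_ ∧ _))

/-- The link state obtained by stacking a generator that does not contract two through-lines. -/
def cap (s : LinkState N k) (i : Fin (N - 1)) (h : ¬ s.BothThrough i) : LinkState N k where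
  partner := stack s.partner (fstSite i) (sndSite i)
  invol := stack_invol s.invol (fst_ne_snd i)
  noncrossing a b hab hb :=
    (stack_planar s.invol s.noncrossing s.uncovered rfl a b hab hb).1
  uncovered a b hab hb :=
    (stack_planar s.invol s.noncrossing s.uncovered rfl a b hab hb).2
  card_through := (stack_card s.invol (fst_ne_snd i) h).trans s.card_through

end LinkState

/-- The standard module with `k` through-lines on `N` sites (spin `k / 2`): the vector space
spanned by the link states. -/
def Standard (_δ : ℂ) (N k : ℕ) : Type := LinkState N k →₀ ℂ

instance (δ : ℂ) (N k : ℕ) : AddCommGroup (Standard δ N k) :=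
  inferInstanceAs (AddCommGroup (LinkState N k →₀ ℂ))

instance (δ : ℂ) (N k : ℕ) : Module ℂ (Standard δ N k) :=
  inferInstanceAs (Module ℂ (LinkState N k →₀ ℂ))

namespace Standard

variable {δ : ℂ} {N k : ℕ}

/-- The basis of link states. -/
def basis (δ : ℂ) (N k : ℕ) : Module.Basis (LinkState N k) ℂ (Standard δ N k) :=
  ⟨LinearEquiv.refl ℂ (LinkState N k →₀ ℂ)⟩

open LinkState

/-- The result of stacking a generator on a link state: zero if two through-lines are contracted;
otherwise the stacked diagram, with a factor `δ` if a loop is closed. -/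
def genVec (δ : ℂ) (i : Fin (N - 1)) (s : LinkState N k) : Standard δ N k :=
  if h : s.BothThrough i then 0
  else (if s.partner (fstSite i) = sndSite i then δ else 1) • basis δ N k (s.cap i h)

theorem genVec_of_through {i : Fin (N - 1)} {s : LinkState N k} (h : s.BothThrough i) :
    genVec δ i s = 0 := dif_pos h

theorem genVec_of_not {i : Fin (N - 1)} {s : LinkState N k} (h : ¬ s.BothThrough i) :
    genVec δ i s =
      (if s.partner (fstSite i) = sndSite i then δ else 1) • basis δ N k (s.cap i h) := dif_neg h

/-- The operator by which a generator acts on the standard module. -/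
def genAct (δ : ℂ) (N k : ℕ) (i : Fin (N - 1)) : Module.End ℂ (Standard δ N k) :=
  (basis δ N k).constr ℂ (genVec δ i)

theorem genAct_basis (i : Fin (N - 1)) (s : LinkState N k) :
    genAct δ N k i (basis δ N k s) = genVec δ i s :=
  (basis δ N k).constr_basis ℂ _ _

theorem genAct_sq (i : Fin (N - 1)) : genAct δ N k i * genAct δ N k i = δ • genAct δ N k i := by
  refine (basis δ N k).ext fun s => ?_
  rw [Module.End.mul_apply, LinearMap.smul_apply, genAct_basis]
  by_cases h : s.BothThrough i
  · simp [genVec, h]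
  · have ht : (s.cap i h).partner (fstSite i) = sndSite i := by simp [cap, stack]
    have hn : ¬ (s.cap i h).BothThrough i := fun e => fst_ne_snd i (e.1.symm.trans ht)
    have hc : (s.cap i h).cap i hn = s.cap i h := by
      ext1
      exact stack_of_arc (s.cap i h).invol ht
    have e1 : genVec δ i s =
        (if s.partner (fstSite i) = sndSite i then δ else 1) • basis δ N k (s.cap i h) := by
      simp [genVec, h]
    have e2 : genVec δ i (s.cap i h) = δ • basis δ N k (s.cap i h) := by
      simp [genVec, hn, ht, hc]
    rw [e1, map_smul, genAct_basis, e2, smul_comm]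

theorem genAct_braid (i j : Fin (N - 1)) (hij : (i : ℕ) + 1 = j ∨ (j : ℕ) + 1 = i) :
    genAct δ N k i * genAct δ N k j * genAct δ N k i = genAct δ N k i := by
  refine (basis δ N k).ext fun s => ?_
  rw [Module.End.mul_apply, Module.End.mul_apply, genAct_basis]
  by_cases h : s.BothThrough i
  · simp [genVec, h]
  · have hadj : fstSite i = sndSite j ∧ sndSite i ≠ fstSite j ∨
        sndSite i = fstSite j ∧ fstSite i ≠ sndSite j := by
      simp only [fstSite, sndSite, Fin.ext_iff, ne_eq]
      omega
    have hi := fst_ne_snd i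
    have hj := fst_ne_snd j
    have e1 : genVec δ i s =
        (if s.partner (fstSite i) = sndSite i then δ else 1) • basis δ N k (s.cap i h) := by
      simp [genVec, h]
    have ht1 : (s.cap i h).partner (fstSite i) = sndSite i := by simp [cap, stack]
    have ht2 : (s.cap i h).partner (sndSite i) = fstSite i := by
      rw [← ht1, (s.cap i h).invol]
    have hn : ¬ (s.cap i h).BothThrough j := by
      unfold BothThrough; grind
    have hw : (s.cap i h).partner (fstSite j) ≠ sndSite j := by
      have := (s.cap i h).invol (fstSite j)
      grind
    have e2 : genVec δ j (s.cap i h) = basis δ N k ((s.cap i h).cap j hn) := by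
      simp [genVec, hn, hw]
    have hu1 : ((s.cap i h).cap j hn).partner (fstSite j) = sndSite j := by simp [cap, stack]
    have hu2 : ((s.cap i h).cap j hn).partner (sndSite j) = fstSite j := by
      rw [← hu1, ((s.cap i h).cap j hn).invol]
    have hm : ¬ ((s.cap i h).cap j hn).BothThrough i := by
      unfold BothThrough; grind
    have hv : ((s.cap i h).cap j hn).partner (fstSite i) ≠ sndSite i := by
      have := ((s.cap i h).cap j hn).invol (fstSite i)
      grind
    have hc : ((s.cap i h).cap j hn).cap i hm = s.cap i h := by
      ext1
      exact stack_braid s.invol hi hj hadj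
    have e3 : genVec δ i ((s.cap i h).cap j hn) = basis δ N k (s.cap i h) := by
      simp [genVec, hm, hv, hc]
    rw [e1, map_smul, genAct_basis, e2, map_smul, genAct_basis, e3]

theorem genAct_comm (i j : Fin (N - 1)) (hij : (i : ℕ) + 2 ≤ j ∨ (j : ℕ) + 2 ≤ i) :
    genAct δ N k i * genAct δ N k j = genAct δ N k j * genAct δ N k i := by
  refine (basis δ N k).ext fun s => ?_
  rw [Module.End.mul_apply, Module.End.mul_apply, genAct_basis, genAct_basis]
  have hi := fst_ne_snd i
  have hj := fst_ne_snd j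
  have h1 : fstSite i ≠ fstSite j := by simp [fstSite]; omega
  have h2 : fstSite i ≠ sndSite j := by simp [fstSite, sndSite]; omega
  have h3 : sndSite i ≠ fstSite j := by simp [fstSite, sndSite]; omega
  have h4 : sndSite i ≠ sndSite j := by simp [sndSite]; omega
  have still : ∀ (i j : Fin (N - 1)) (_ : fstSite i ≠ fstSite j) (_ : fstSite i ≠ sndSite j)
      (_ : sndSite i ≠ fstSite j) (_ : sndSite i ≠ sndSite j) (_ : s.BothThrough i)
      (b : ¬ s.BothThrough j), (s.cap j b).BothThrough i := by
    intro i j g1 g2 g3 g4 a b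
    unfold BothThrough at a ⊢
    simp only [cap, stack]
    grind
  by_cases a : s.BothThrough i <;> by_cases b : s.BothThrough j
  · simp [genVec, a, b]
  · have c := still i j h1 h2 h3 h4 a b
    rw [genVec_of_through a, genVec_of_not b, map_smul, genAct_basis, genVec_of_through c, map_zero,
      smul_zero]
  · have c := still j i h1.symm h3.symm h2.symm h4.symm b a
    rw [genVec_of_through b, genVec_of_not a, map_smul, genAct_basis, genVec_of_through c, map_zero,
      smul_zero]
  · have z : (s.cap i a).BothThrough j ↔ (s.cap j b).BothThrough i :=
      ⟨stack_both_through s.invol hi hj h1 h2 h3 h4 b,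
        stack_both_through s.invol hj hi h1.symm h3.symm h2.symm h4.symm a⟩
    have e1 : genVec δ i s =
        (if s.partner (fstSite i) = sndSite i then δ else 1) • basis δ N k (s.cap i a) :=
      genVec_of_not a
    have e2 : genVec δ j s =
        (if s.partner (fstSite j) = sndSite j then δ else 1) • basis δ N k (s.cap j b) :=
      genVec_of_not b
    rw [e1, e2, map_smul, map_smul, genAct_basis, genAct_basis]
    by_cases c : (s.cap i a).BothThrough j
    · simp [genVec, c, z.1 c]
    · have c' : ¬ (s.cap j b).BothThrough i := fun e => c (z.2 e)
      have hc : (s.cap j b).cap i c' = (s.cap i a).cap j c := by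
        ext1
        exact stack_comm s.invol hj hi h1.symm h3.symm h2.symm h4.symm
      have e3 : genVec δ j (s.cap i a) =
          (if (s.cap i a).partner (fstSite j) = sndSite j then δ else 1) •
            basis δ N k ((s.cap i a).cap j c) := by
        simp [genVec, c]
      have e4 : genVec δ i (s.cap j b) =
          (if (s.cap j b).partner (fstSite i) = sndSite i then δ else 1) •
            basis δ N k ((s.cap i a).cap j c) := by
        simp [genVec, c', hc]
      rw [e3, e4, smul_smul, smul_smul]
      congr 1
      have w1 : s.partner (fstSite j) = sndSite j →
          (s.cap i a).partner (fstSite j) = sndSite j :=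
        stack_arc_of_eq s.invol h1.symm h3.symm h2.symm h4.symm
      have w2 : s.partner (fstSite i) = sndSite i →
          (s.cap j b).partner (fstSite i) = sndSite i :=
        stack_arc_of_eq s.invol h1 h2 h3 h4
      have w3 : s.partner (fstSite i) = sndSite i → (s.cap i a).partner = s.partner :=
        stack_of_arc s.invol
      have w4 : s.partner (fstSite j) = sndSite j → (s.cap j b).partner = s.partner :=
        stack_of_arc s.invol
      have w5 : s.partner (fstSite i) ≠ sndSite i → s.partner (fstSite j) ≠ sndSite j →
          (s.cap i a).partner (fstSite j) = sndSite j →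
          (s.cap j b).partner (fstSite i) = sndSite i :=
        fun _ b => stack_arc_of_ne s.invol hj h1 h2 h3 h4 b
      have w6 : s.partner (fstSite j) ≠ sndSite j → s.partner (fstSite i) ≠ sndSite i →
          (s.cap j b).partner (fstSite i) = sndSite i →
          (s.cap i a).partner (fstSite j) = sndSite j :=
        fun _ b => stack_arc_of_ne s.invol hi h1.symm h3.symm h2.symm h4.symm b
      grind

/-- The representation of the Temperley-Lieb algebra on the standard module. -/
def rep (δ : ℂ) (N k : ℕ) : TL δ N →ₐ[ℂ] Module.End ℂ (Standard δ N k) :=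
  lift (genAct δ N k) genAct_sq genAct_braid genAct_comm

instance (δ : ℂ) (N k : ℕ) : Module (TL δ N) (Standard δ N k) :=
  Module.compHom (Standard δ N k) (rep δ N k).toRingHom

theorem smul_def (a : TL δ N) (x : Standard δ N k) : a • x = rep δ N k a x := rfl

theorem gen_smul_basis (i : Fin (N - 1)) (s : LinkState N k) :
    gen δ N i • basis δ N k s = genVec δ i s := by
  rw [smul_def, rep, lift_gen, genAct_basis]

instance (δ : ℂ) (N k : ℕ) : IsScalarTower ℂ (TL δ N) (Standard δ N k) where
  smul_assoc c a x := by
    rw [smul_def, smul_def, map_smul, LinearMap.smul_apply]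

end Standard

end TemperleyLieb

end

noncomputable section

namespace TemperleyLieb

/-! ### Jones-Wenzl projectors -/

/-! Since `q` is not a root of unity, the quantum integers `quantumNat δ n` with `n > 0` are
nonzero, so Jones-Wenzl projectors exist on any number of sites and the Temperley-Lieb algebras are
semisimple. Semisimplicity enters in a concrete form. For `k ≤ m` of the same parity, `proj δ m k`
is the Jones-Wenzl projector on the first `k` sites times one generator, divided by `δ`, on each of
the remaining `(m - k) / 2` pairs of neighbouring sites. These idempotents are pairwise
inequivalent, have scalar corners and generate the unit ideal (`isCellSystem_proj`). Hence every
family of linear maps between the corners `range (ρ (π k))` of two representations extends uniquely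
to an intertwiner, and representations with isomorphic corners are isomorphic
(`IsCellSystem.exists_equiv`).

It remains to find the dimensions of corners. The rank of an idempotent is its trace, so for
standard modules this is a character computation. A generator on two new sites multiplies the
character by `δ` (`character_inclLeft_mul_gen'`), forgetting one site follows the branching rule `k
+ 1 ↦ k, k + 2` (`character_inclLeft_one_succ`), and the Jones-Wenzl recursion becomes a Chebyshev
recursion for characters (`character_jonesWenzl_add_two`). Its solution is the Clebsch-Gordan rule:
the corner of index `j` in the standard module `k` is a line if `j = k` and zero otherwise
(`character_proj`), and the corner of index `(k₁, k₂)` in its restriction has dimension one or zero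
according to `Triangle k₁ k₂ k` (`character_proj_mul_proj`).

Frobenius reciprocity identifies the intertwiners from the fusion to the standard module `k` with
those from the tensor product to its restriction. Each side lives on a single corner: the first is
the dual of the corner `k` of the fusion, the second is isomorphic to the corner `(k₁, k₂)` of the
restriction. Therefore the fusion and the direct sum have corners of equal dimension
(`finrank_range_fusion`). -/

/-- The quantum integers, as polynomials in the loop fugacity. -/
def quantumNat (δ : ℂ) : ℕ → ℂ
  | 0 => 0
  | 1 => 1
  | n + 2 => δ * quantumNat δ (n + 1) - quantumNat δ n

/-- The usual closed form of the quantum integers, with the denominator cleared so that no division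
by `q - q⁻¹` occurs. -/
theorem quantumNat_mul_sub (q : ℂ) (hq₀ : q ≠ 0) (n : ℕ) :
    quantumNat (q + q⁻¹) n * (q - q⁻¹) = q ^ n - q⁻¹ ^ n := by
  induction n using Nat.twoStepInduction with
  | zero => simp [quantumNat]
  | one => simp [quantumNat]
  | more n h1 h2 =>
    have h3 : q * q⁻¹ = 1 := mul_inv_cancel₀ hq₀
    rw [quantumNat, sub_mul, mul_assoc, h1, h2]
    linear_combination (q ^ n - q⁻¹ ^ n) * h3

/-- A zero at `n` would give `q ^ n = q⁻¹ ^ n`, hence `q ^ (2 * n) = 1`. -/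
theorem quantumNat_ne_zero {q : ℂ} (hq₀ : q ≠ 0) (hq : ∀ n : ℕ, 0 < n → q ^ n ≠ 1) {n : ℕ}
    (hn : 0 < n) : quantumNat (q + q⁻¹) n ≠ 0 := by
  intro h
  have h1 := quantumNat_mul_sub q hq₀ n
  rw [h, zero_mul] at h1
  have h3 : q ^ n * q⁻¹ ^ n = 1 := by rw [← mul_pow, mul_inv_cancel₀ hq₀, one_pow]
  refine hq (n + n) (by omega) ?_
  rw [pow_add]
  linear_combination -q ^ n * h1 + h3

section JonesWenzl

variable {B : Type*} [Ring B] [Algebra ℂ B]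

/-- The elements `e 0, …, e (N - 2)` satisfy the Temperley-Lieb relations on `N` sites. -/
structure IsTLSeq (δ : ℂ) (N : ℕ) (e : ℕ → B) : Prop where
  sq : ∀ i, i + 1 < N → e i * e i = δ • e i
  up : ∀ i, i + 2 < N → e i * e (i + 1) * e i = e i
  down : ∀ i, i + 2 < N → e (i + 1) * e i * e (i + 1) = e (i + 1)
  comm : ∀ i j, i + 2 ≤ j → j + 1 < N → Commute (e i) (e j)

/-- The Jones-Wenzl element on `n` sites built from a sequence of elements. -/
def jonesWenzl (δ : ℂ) (e : ℕ → B) : ℕ → B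
  | 0 => 1
  | n + 1 => jonesWenzl δ e n - (quantumNat δ n / quantumNat δ (n + 1)) •
      (jonesWenzl δ e n * e (n - 1) * jonesWenzl δ e n)

theorem jonesWenzl_zero (δ : ℂ) (e : ℕ → B) : jonesWenzl δ e 0 = 1 := rfl

/-- The correction term has coefficient `quantumNat δ 0 / quantumNat δ 1 = 0`, so the truncated
index `0 - 1` in the recursion does no harm. -/
theorem jonesWenzl_one (δ : ℂ) (e : ℕ → B) : jonesWenzl δ e 1 = 1 := by
  simp [jonesWenzl, quantumNat]

theorem jonesWenzl_succ_succ (δ : ℂ) (e : ℕ → B) (n : ℕ) :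
    jonesWenzl δ e (n + 2) = jonesWenzl δ e (n + 1) -
      (quantumNat δ (n + 1) / quantumNat δ (n + 2)) •
        (jonesWenzl δ e (n + 1) * e n * jonesWenzl δ e (n + 1)) := rfl

theorem map_jonesWenzl {C : Type*} [Ring C] [Algebra ℂ C] (f : B →ₐ[ℂ] C) (δ : ℂ) (e : ℕ → B)
    (n : ℕ) : f (jonesWenzl δ e n) = jonesWenzl δ (fun i => f (e i)) n := by
  induction n with
  | zero => simp [jonesWenzl]
  | succ n ih => simp [jonesWenzl, ih]

theorem jonesWenzl_congr {δ : ℂ} {e e' : ℕ → B} {n : ℕ} (h : ∀ i, i + 1 < n → e i = e' i) :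
    jonesWenzl δ e n = jonesWenzl δ e' n := by
  induction n with
  | zero => rfl
  | succ n ih =>
    cases n with
    | zero => simp [jonesWenzl_one]
    | succ n =>
      rw [jonesWenzl_succ_succ, jonesWenzl_succ_succ, ih fun i hi => h i (by omega),
        h n (by omega)]

theorem commute_jonesWenzl {δ : ℂ} {e : ℕ → B} {n : ℕ} {x : B}
    (h : ∀ i, i + 1 < n → Commute x (e i)) : Commute x (jonesWenzl δ e n) := by
  induction n with
  | zero => exact Commute.one_right x
  | succ n ih =>
    cases n with
    | zero => rw [jonesWenzl_one]; exact Commute.one_right x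
    | succ n =>
      have h1 := ih fun i hi => h i (by omega)
      exact h1.sub_right (((h1.mul_right (h n (by omega))).mul_right h1).smul_right _)

variable {δ : ℂ} {N : ℕ} {e : ℕ → B}

theorem IsTLSeq.commute_jonesWenzl (he : IsTLSeq δ N e) {n j : ℕ} (hj : n ≤ j) (hN : j + 1 < N) :
    Commute (e j) (jonesWenzl δ e n) :=
  TemperleyLieb.commute_jonesWenzl fun i hi => (he.comm i j (by omega) hN).symm

/-- This is the partial trace of a Jones-Wenzl projector over its last strand. Expanding by the
recursion leaves `e m * e m` and `e m * e (m - 1) * e m`, because the smaller projector commutes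
with `e m`; the coefficients combine by the recursion of the quantum integers. Idempotence is a
hypothesis since it is established in the same induction that uses this lemma. -/
theorem IsTLSeq.gen_jonesWenzl_gen_aux (he : IsTLSeq δ N e)
    (hu : ∀ n, 0 < n → quantumNat δ n ≠ 0) {m : ℕ} (hm : m + 1 < N)
    (hidem : jonesWenzl δ e m * jonesWenzl δ e m = jonesWenzl δ e m) :
    e m * jonesWenzl δ e (m + 1) * e m =
      (quantumNat δ (m + 2) / quantumNat δ (m + 1)) • (jonesWenzl δ e m * e m) := by
  have hc := (he.commute_jonesWenzl le_rfl hm).eq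
  have h1 := hu (m + 1) (by omega)
  cases m with
  | zero => simp [jonesWenzl_one, jonesWenzl_zero, he.sq 0 hm, quantumNat]
  | succ m =>
    have h2 : e (m + 1) * jonesWenzl δ e (m + 1) * e (m + 1) =
        δ • (jonesWenzl δ e (m + 1) * e (m + 1)) := by
      rw [hc, mul_assoc, he.sq _ hm, mul_smul_comm]
    have h3 : e (m + 1) * (jonesWenzl δ e (m + 1) * e m * jonesWenzl δ e (m + 1)) * e (m + 1) =
        jonesWenzl δ e (m + 1) * e (m + 1) := by
      calc _ = (e (m + 1) * jonesWenzl δ e (m + 1)) * e m *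
            (jonesWenzl δ e (m + 1) * e (m + 1)) := by noncomm_ring
        _ = jonesWenzl δ e (m + 1) * (e (m + 1) * e m * e (m + 1)) * jonesWenzl δ e (m + 1) := by
          rw [← hc]; nth_rewrite 1 [hc]; noncomm_ring
        _ = _ := by rw [he.down m (by omega), mul_assoc, hc, ← mul_assoc, hidem]
    rw [jonesWenzl_succ_succ, mul_sub, sub_mul, h2, mul_smul_comm, smul_mul_assoc, h3, ← sub_smul]
    congr 1
    rw [show quantumNat δ (m + 1 + 2) = δ * quantumNat δ (m + 2) - quantumNat δ (m + 1) from rfl]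
    field_simp

/-- The coefficient in the recursion is the inverse of the partial trace factor, which is exactly
what makes the new generator annihilate the new projector. The induction is two-step because the
partial trace formula needs idempotence two levels down. -/
theorem IsTLSeq.jonesWenzl_props (he : IsTLSeq δ N e)
    (hu : ∀ n, 0 < n → quantumNat δ n ≠ 0) (n : ℕ) (hn : n ≤ N) :
    jonesWenzl δ e n * jonesWenzl δ e n = jonesWenzl δ e n ∧
    (∀ i, i + 1 < n → e i * jonesWenzl δ e n = 0) ∧
    (∀ i, i + 1 < n → jonesWenzl δ e n * e i = 0) := by
  induction n using Nat.twoStepInduction with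
  | zero => simp [jonesWenzl_zero]
  | one => simp [jonesWenzl_one]
  | more m ih0 ih1 =>
    obtain ⟨i0, -, -⟩ := ih0 (by omega)
    obtain ⟨i1, l1, r1⟩ := ih1 (by omega)
    have h4 := he.gen_jonesWenzl_gen_aux hu (m := m) (by omega) i0
    have hc := (he.commute_jonesWenzl (n := m) le_rfl (by omega)).eq
    have hs : (quantumNat δ (m + 1) / quantumNat δ (m + 2)) *
        (quantumNat δ (m + 2) / quantumNat δ (m + 1)) = 1 := by
      have := hu (m + 1) (by omega)
      have := hu (m + 2) (by omega)
      field_simp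
    have habs : jonesWenzl δ e m * jonesWenzl δ e (m + 1) = jonesWenzl δ e (m + 1) := by
      rw [jonesWenzl, mul_sub, mul_smul_comm, ← mul_assoc, ← mul_assoc, i0]
    have habs' : jonesWenzl δ e (m + 1) * jonesWenzl δ e m = jonesWenzl δ e (m + 1) := by
      rw [jonesWenzl, sub_mul, smul_mul_assoc, mul_assoc, i0]
    have hl : e m * jonesWenzl δ e (m + 2) = 0 := by
      rw [jonesWenzl_succ_succ, mul_sub, mul_smul_comm, ← mul_assoc, ← mul_assoc, h4,
        smul_mul_assoc, ← hc, mul_assoc, habs, smul_smul, hs, one_smul, sub_self]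
    have hr : jonesWenzl δ e (m + 2) * e m = 0 := by
      rw [jonesWenzl_succ_succ, sub_mul, smul_mul_assoc, mul_assoc, mul_assoc, ← mul_assoc (e m),
        h4, mul_smul_comm, ← mul_assoc, habs', smul_smul, hs, one_smul, sub_self]
    have hL : ∀ i, i + 1 < m + 2 → e i * jonesWenzl δ e (m + 2) = 0 := by
      intro i hi
      rcases Nat.lt_or_ge i m with h | h
      · rw [jonesWenzl_succ_succ, mul_sub, mul_smul_comm, ← mul_assoc, ← mul_assoc,
          l1 i (by omega), zero_mul, zero_mul, smul_zero, sub_zero]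
      · obtain rfl : i = m := by omega
        exact hl
    have hR : ∀ i, i + 1 < m + 2 → jonesWenzl δ e (m + 2) * e i = 0 := by
      intro i hi
      rcases Nat.lt_or_ge i m with h | h
      · rw [jonesWenzl_succ_succ, sub_mul, smul_mul_assoc, mul_assoc, mul_assoc,
          r1 i (by omega), mul_zero, mul_zero, smul_zero, sub_zero]
      · obtain rfl : i = m := by omega
        exact hr
    refine ⟨?_, hL, hR⟩
    -- The new projector absorbs the previous one and kills `e m`, so multiplying the recursion by
    -- it leaves only the leading term.
    have h5 : jonesWenzl δ e (m + 2) * jonesWenzl δ e (m + 1) = jonesWenzl δ e (m + 2) := by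
      rw [jonesWenzl_succ_succ, sub_mul, smul_mul_assoc, mul_assoc _ _ (jonesWenzl δ e (m + 1)), i1]
    conv_lhs => rw [jonesWenzl_succ_succ δ e m]
    rw [← jonesWenzl_succ_succ, jonesWenzl_succ_succ δ e m]
    conv_lhs => rw [mul_sub]
    rw [← jonesWenzl_succ_succ, h5, mul_smul_comm, ← mul_assoc, ← mul_assoc, h5, hr]
    simp

theorem IsTLSeq.gen_jonesWenzl_gen (he : IsTLSeq δ N e)
    (hu : ∀ n, 0 < n → quantumNat δ n ≠ 0) {m : ℕ} (hm : m + 1 < N) :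
    e m * jonesWenzl δ e (m + 1) * e m =
      (quantumNat δ (m + 2) / quantumNat δ (m + 1)) • (jonesWenzl δ e m * e m) :=
  he.gen_jonesWenzl_gen_aux hu hm (he.jonesWenzl_props hu m (by omega)).1

end JonesWenzl

/-! ### Generators indexed by natural numbers, and inclusions -/

/-- The generators, extended by zero. -/
def gen' (δ : ℂ) (N i : ℕ) : TL δ N := if h : i < N - 1 then gen δ N ⟨i, h⟩ else 0

theorem gen'_of_lt (δ : ℂ) {N i : ℕ} (h : i < N - 1) : gen' δ N i = gen δ N ⟨i, h⟩ := dif_pos h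

theorem gen'_of_ge (δ : ℂ) {N i : ℕ} (h : ¬ i < N - 1) : gen' δ N i = 0 := dif_neg h

theorem isTLSeq_gen' (δ : ℂ) (N : ℕ) : IsTLSeq δ N (gen' δ N) where
  sq i hi := by rw [gen'_of_lt δ (by omega), gen_sq]
  up i hi := by
    rw [gen'_of_lt δ (by omega), gen'_of_lt δ (by omega), gen_braid _ _ _ _ (Or.inl rfl)]
  down i hi := by
    rw [gen'_of_lt δ (by omega), gen'_of_lt δ (by omega), gen_braid _ _ _ _ (Or.inr rfl)]
  comm i j h hj := by
    rw [gen'_of_lt δ (by omega), gen'_of_lt δ (by omega)]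
    exact gen_comm _ _ _ _ (Or.inl h)

theorem TL.induction {δ : ℂ} {N : ℕ} {p : TL δ N → Prop} (hs : ∀ c : ℂ, p (algebraMap ℂ _ c))
    (hg : ∀ i, i + 1 < N → p (gen' δ N i)) (ha : ∀ x y, p x → p y → p (x + y))
    (hm : ∀ x y, p x → p y → p (x * y)) (x : TL δ N) : p x := by
  have hx : x ∈ Algebra.adjoin ℂ (Set.range (gen δ N)) := by rw [adjoin_gen]; trivial
  induction hx using Algebra.adjoin_induction with
  | algebraMap r => exact hs r
  | add x y _ _ hx hy => exact ha x y hx hy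
  | mul x y _ _ hx hy => exact hm x y hx hy
  | mem x hx =>
    obtain ⟨i, rfl⟩ := hx
    have := hg i (by omega)
    rwa [gen'_of_lt δ i.2] at this

theorem TL.algHom_ext {δ : ℂ} {N : ℕ} {B : Type*} [Ring B] [Algebra ℂ B] {f g : TL δ N →ₐ[ℂ] B}
    (h : ∀ i, i + 1 < N → f (gen' δ N i) = g (gen' δ N i)) : f = g := by
  ext x
  induction x using TL.induction with
  | hs c => simp
  | hg i hi => exact h i hi
  | ha x y hx hy => rw [map_add, map_add, hx, hy]
  | hm x y hx hy => rw [map_mul, map_mul, hx, hy]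

theorem inclLeft_gen' (δ : ℂ) {N₁ : ℕ} (N₂ : ℕ) {i : ℕ} (h : i + 1 < N₁) :
    inclLeft δ N₁ N₂ (gen' δ N₁ i) = gen' δ (N₁ + N₂) i := by
  rw [gen'_of_lt δ (by omega), gen'_of_lt δ (by omega), inclLeft, lift_gen]

/-- No bound on `i` is needed: beyond the last generator both sides take the default value zero. On
the left factor this fails, as `gen' δ (N₁ + N₂) i` may be a genuine generator for `i + 1 ≥ N₁`. -/
theorem inclRight_gen' (δ : ℂ) (N₁ N₂ i : ℕ) :
    inclRight δ N₁ N₂ (gen' δ N₂ i) = gen' δ (N₁ + N₂) (N₁ + i) := by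
  by_cases h : i < N₂ - 1
  · rw [gen'_of_lt δ h, gen'_of_lt δ (by omega), inclRight, lift_gen]
  · rw [gen'_of_ge δ h, gen'_of_ge δ (by omega), map_zero]

/-- Associativity of juxtaposition, for one or two extra sites. With these literals the two
bracketings of the number of sites agree definitionally, so the statements need no transport. -/
theorem inclLeft_inclLeft_one (δ : ℂ) (N₁ N₂ : ℕ) (x : TL δ N₁) :
    inclLeft δ (N₁ + N₂) 1 (inclLeft δ N₁ N₂ x) = inclLeft δ N₁ (N₂ + 1) x := by
  refine DFunLike.congr_fun
    (TL.algHom_ext (f := (inclLeft δ (N₁ + N₂) 1).comp (inclLeft δ N₁ N₂)) fun i hi => ?_) x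
  rw [AlgHom.comp_apply, inclLeft_gen' δ N₂ hi, inclLeft_gen' δ 1 (by omega),
    inclLeft_gen' δ (N₂ + 1) hi]
  rfl

theorem inclLeft_inclLeft_two (δ : ℂ) (N₁ N₂ : ℕ) (x : TL δ N₁) :
    inclLeft δ (N₁ + N₂) 2 (inclLeft δ N₁ N₂ x) = inclLeft δ N₁ (N₂ + 2) x := by
  refine DFunLike.congr_fun
    (TL.algHom_ext (f := (inclLeft δ (N₁ + N₂) 2).comp (inclLeft δ N₁ N₂)) fun i hi => ?_) x
  rw [AlgHom.comp_apply, inclLeft_gen' δ N₂ hi, inclLeft_gen' δ 2 (by omega),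
    inclLeft_gen' δ (N₂ + 2) hi]
  rfl

theorem inclLeft_inclRight_one (δ : ℂ) (N₁ N₂ : ℕ) (x : TL δ N₂) :
    inclLeft δ (N₁ + N₂) 1 (inclRight δ N₁ N₂ x) = inclRight δ N₁ (N₂ + 1) (inclLeft δ N₂ 1 x) := by
  refine DFunLike.congr_fun
    (TL.algHom_ext (f := (inclLeft δ (N₁ + N₂) 1).comp (inclRight δ N₁ N₂))
      (g := (inclRight δ N₁ (N₂ + 1)).comp (inclLeft δ N₂ 1)) fun i hi => ?_) x
  rw [AlgHom.comp_apply, AlgHom.comp_apply, inclRight_gen', inclLeft_gen' δ 1 (by omega),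
    inclLeft_gen' δ 1 hi, inclRight_gen']
  rfl

theorem inclLeft_inclRight_two (δ : ℂ) (N₁ N₂ : ℕ) (x : TL δ N₂) :
    inclLeft δ (N₁ + N₂) 2 (inclRight δ N₁ N₂ x) = inclRight δ N₁ (N₂ + 2) (inclLeft δ N₂ 2 x) := by
  refine DFunLike.congr_fun
    (TL.algHom_ext (f := (inclLeft δ (N₁ + N₂) 2).comp (inclRight δ N₁ N₂))
      (g := (inclRight δ N₁ (N₂ + 2)).comp (inclLeft δ N₂ 2)) fun i hi => ?_) x
  rw [AlgHom.comp_apply, AlgHom.comp_apply, inclRight_gen', inclLeft_gen' δ 2 (by omega),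
    inclLeft_gen' δ 2 hi, inclRight_gen']
  rfl

theorem commute_inclLeft_gen' (δ : ℂ) (N : ℕ) (x : TL δ N) :
    Commute (inclLeft δ N 2 x) (gen' δ (N + 2) N) := by
  have h := incl_commute δ N 2 x (gen' δ 2 0)
  rwa [inclRight_gen'] at h

/-! ### The sandwich property -/

/-- The words of `TL_{m+2}` in which the last generator appears at most once. -/
def sandwichSpan (δ : ℂ) (m : ℕ) : Submodule ℂ (TL δ (m + 2)) :=
  Submodule.span ℂ
    (Set.range (inclLeft δ (m + 1) 1) ∪ Set.range fun ab : TL δ (m + 1) × TL δ (m + 1) =>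
      inclLeft δ (m + 1) 1 ab.1 * gen' δ (m + 2) m * inclLeft δ (m + 1) 1 ab.2)

/-- The span contains `1` and is stable under left multiplication by generators. The only case with
two copies of the last generator is `e * a * e * b`, and the hypothesis collapses it to one. -/
theorem sandwichSpan_eq_top {δ : ℂ} {m : ℕ}
    (h : ∀ x : TL δ (m + 1), ∃ y : TL δ m, gen' δ (m + 2) m * inclLeft δ (m + 1) 1 x *
      gen' δ (m + 2) m = inclLeft δ m 2 y * gen' δ (m + 2) m) (x : TL δ (m + 2)) :
    x ∈ sandwichSpan δ m := by
  have hl : ∀ a, inclLeft δ (m + 1) 1 a ∈ sandwichSpan δ m := fun a =>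
    Submodule.subset_span (Or.inl ⟨a, rfl⟩)
  have hr : ∀ a b, inclLeft δ (m + 1) 1 a * gen' δ (m + 2) m * inclLeft δ (m + 1) 1 b ∈
      sandwichSpan δ m := fun a b => Submodule.subset_span (Or.inr ⟨(a, b), rfl⟩)
  suffices H : ∀ x : TL δ (m + 2), ∀ s ∈ sandwichSpan δ m, x * s ∈ sandwichSpan δ m by
    simpa using H x 1 (by simpa using hl 1)
  intro x
  induction x using TL.induction with
  | hs c =>
    intro s hs
    rw [← Algebra.smul_def]
    exact Submodule.smul_mem _ _ hs
  | ha x y hx hy => intro s hs; rw [add_mul]; exact add_mem (hx s hs) (hy s hs)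
  | hm x y hx hy => intro s hs; rw [mul_assoc]; exact hx _ (hy s hs)
  | hg i hi =>
    intro s hs
    induction hs using Submodule.span_induction with
    | zero => simp
    | add x y _ _ hx hy => rw [mul_add]; exact add_mem hx hy
    | smul c x _ hx => rw [mul_smul_comm]; exact Submodule.smul_mem _ _ hx
    | mem s hs =>
      rcases Nat.lt_or_ge i m with him | him
      · have hi' : gen' δ (m + 2) i = inclLeft δ (m + 1) 1 (gen' δ (m + 1) i) :=
          (inclLeft_gen' δ 1 (by omega)).symm
        rw [hi']
        rcases hs with ⟨a, rfl⟩ | ⟨⟨a, b⟩, rfl⟩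
        · rw [← map_mul]; exact hl _
        · simp only [← mul_assoc]
          rw [← map_mul]
          exact hr _ _
      · obtain rfl : i = m := by omega
        rcases hs with ⟨a, rfl⟩ | ⟨⟨a, b⟩, rfl⟩
        · simpa using hr 1 a
        · obtain ⟨y, hy⟩ := h a
          simp only [← mul_assoc]
          rw [hy, ← inclLeft_inclLeft_one δ i 1]
          exact hr _ _

/-- In diagrams, `y` is `x` with its last strand closed up. Algebraically, the previous case lets
`x` be written with its last generator occurring at most once; then either `e * e = δ • e` or `e (m
+ 1) * e m * e (m + 1) = e (m + 1)` applies. The base case holds because `TL δ 1` consists of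
scalars. -/
theorem exists_gen'_mul_inclLeft_mul_gen' (δ : ℂ) (m : ℕ) (x : TL δ (m + 1)) :
    ∃ y : TL δ m, gen' δ (m + 2) m * inclLeft δ (m + 1) 1 x * gen' δ (m + 2) m =
      inclLeft δ m 2 y * gen' δ (m + 2) m := by
  induction m with
  | zero =>
    obtain ⟨c, rfl⟩ : ∃ c : ℂ, x = algebraMap ℂ _ c := by
      induction x using TL.induction with
      | hs c => exact ⟨c, rfl⟩
      | hg i hi => omega
      | ha x y hx hy =>
        obtain ⟨c, rfl⟩ := hx
        obtain ⟨d, rfl⟩ := hy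
        exact ⟨c + d, by simp⟩
      | hm x y hx hy =>
        obtain ⟨c, rfl⟩ := hx
        obtain ⟨d, rfl⟩ := hy
        exact ⟨c * d, by simp⟩
    refine ⟨algebraMap ℂ _ (c * δ), ?_⟩
    have h := (isTLSeq_gen' δ 2).sq 0 (by omega)
    rw [AlgHom.commutes, AlgHom.commutes, ← Algebra.commutes, mul_assoc, h, ← Algebra.smul_def,
      ← Algebra.smul_def, smul_smul]
  | succ m ih =>
    have he := isTLSeq_gen' δ (m + 3)
    have hx := sandwichSpan_eq_top ih x
    have hc : ∀ a : TL δ (m + 1), gen' δ (m + 3) (m + 1) * inclLeft δ (m + 1) 2 a =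
        inclLeft δ (m + 1) 2 a * gen' δ (m + 3) (m + 1) := fun a =>
      (commute_inclLeft_gen' δ (m + 1) a).eq.symm
    have hg : inclLeft δ (m + 2) 1 (gen' δ (m + 2) m) = gen' δ (m + 3) m :=
      inclLeft_gen' δ 1 (by omega)
    have hi : ∀ a : TL δ (m + 1), inclLeft δ (m + 2) 1 (inclLeft δ (m + 1) 1 a) =
        inclLeft δ (m + 1) 2 a := inclLeft_inclLeft_one δ (m + 1) 1
    induction hx using Submodule.span_induction with
    | zero => exact ⟨0, by simp⟩
    | add x y _ _ hx hy =>
      obtain ⟨a, ha⟩ := hx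
      obtain ⟨b, hb⟩ := hy
      exact ⟨a + b, by rw [map_add, mul_add, add_mul, ha, hb, map_add, add_mul]⟩
    | smul c x _ hx =>
      obtain ⟨a, ha⟩ := hx
      exact ⟨c • a, by rw [map_smul, mul_smul_comm, smul_mul_assoc, ha, map_smul, smul_mul_assoc]⟩
    | mem s hs =>
      rcases hs with ⟨a, rfl⟩ | ⟨⟨a, b⟩, rfl⟩
      · refine ⟨δ • a, ?_⟩
        have h := he.sq (m + 1) (by omega)
        rw [hi, hc, mul_assoc, h, mul_smul_comm, map_smul, smul_mul_assoc]
      · refine ⟨a * b, ?_⟩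
        have h := he.down m (by omega)
        simp only [map_mul, hi, hg]
        calc gen' δ (m + 3) (m + 1) * (inclLeft δ (m + 1) 2 a * gen' δ (m + 3) m *
              inclLeft δ (m + 1) 2 b) * gen' δ (m + 3) (m + 1)
            = (gen' δ (m + 3) (m + 1) * inclLeft δ (m + 1) 2 a) * gen' δ (m + 3) m *
              (inclLeft δ (m + 1) 2 b * gen' δ (m + 3) (m + 1)) := by simp only [mul_assoc]
          _ = inclLeft δ (m + 1) 2 a * (gen' δ (m + 3) (m + 1) * gen' δ (m + 3) m *
              gen' δ (m + 3) (m + 1)) * inclLeft δ (m + 1) 2 b := by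
            rw [hc, ← hc b]; simp only [mul_assoc]
          _ = inclLeft δ (m + 1) 2 a * inclLeft δ (m + 1) 2 b * gen' δ (m + 3) (m + 1) := by
            rw [h, mul_assoc, hc, ← mul_assoc]

theorem exists_gen'_mul_mul_gen' (δ : ℂ) (m : ℕ) (x : TL δ (m + 2)) :
    ∃ y : TL δ m, gen' δ (m + 2) m * x * gen' δ (m + 2) m =
      inclLeft δ m 2 y * gen' δ (m + 2) m := by
  have hx := sandwichSpan_eq_top (exists_gen'_mul_inclLeft_mul_gen' δ m) x
  induction hx using Submodule.span_induction with
  | zero => exact ⟨0, by simp⟩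
  | add x y _ _ hx hy =>
    obtain ⟨a, ha⟩ := hx
    obtain ⟨b, hb⟩ := hy
    exact ⟨a + b, by rw [mul_add, add_mul, ha, hb, map_add, add_mul]⟩
  | smul c x _ hx =>
    obtain ⟨a, ha⟩ := hx
    exact ⟨c • a, by rw [mul_smul_comm, smul_mul_assoc, ha, map_smul, smul_mul_assoc]⟩
  | mem s hs =>
    rcases hs with ⟨a, rfl⟩ | ⟨⟨a, b⟩, rfl⟩
    · exact exists_gen'_mul_inclLeft_mul_gen' δ m a
    · obtain ⟨y, hy⟩ := exists_gen'_mul_inclLeft_mul_gen' δ m a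
      obtain ⟨z, hz⟩ := exists_gen'_mul_inclLeft_mul_gen' δ m b
      refine ⟨y * z, ?_⟩
      simp only
      rw [← mul_assoc, ← mul_assoc, hy, mul_assoc, mul_assoc, ← mul_assoc (gen' δ (m + 2) m), hz,
        ← mul_assoc, map_mul]

/-! ### Complete systems of inequivalent primitive idempotents -/

section CellSystem

variable {A : Type*} [Ring A] [Algebra ℂ A] {ι : Type*}

/-- The two-sided ideal generated by a family, as a subspace. -/
def cellSpan (π : ι → A) : Submodule ℂ A :=
  Submodule.span ℂ (Set.range fun t : A × ι × A => t.1 * π t.2.1 * t.2.2)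

theorem mul_mul_mem_cellSpan (π : ι → A) (a b : A) (k : ι) : a * π k * b ∈ cellSpan π :=
  Submodule.subset_span ⟨(a, k, b), rfl⟩

theorem mem_cellSpan (π : ι → A) (k : ι) : π k ∈ cellSpan π := by
  simpa using mul_mul_mem_cellSpan π 1 1 k

theorem mul_mem_cellSpan_left (π : ι → A) (a : A) {x : A} (hx : x ∈ cellSpan π) :
    a * x ∈ cellSpan π := by
  induction hx using Submodule.span_induction with
  | zero => simp
  | add x y _ _ hx hy => rw [mul_add]; exact add_mem hx hy
  | smul c x _ hx => rw [mul_smul_comm]; exact Submodule.smul_mem _ _ hx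
  | mem x hx =>
    obtain ⟨⟨b, k, c⟩, rfl⟩ := hx
    simp only [← mul_assoc]
    exact mul_mul_mem_cellSpan π _ _ _

theorem mul_mem_cellSpan_right (π : ι → A) (a : A) {x : A} (hx : x ∈ cellSpan π) :
    x * a ∈ cellSpan π := by
  induction hx using Submodule.span_induction with
  | zero => simp
  | add x y _ _ hx hy => rw [add_mul]; exact add_mem hx hy
  | smul c x _ hx => rw [smul_mul_assoc]; exact Submodule.smul_mem _ _ hx
  | mem x hx =>
    obtain ⟨⟨b, k, c⟩, rfl⟩ := hx
    simp only [mul_assoc]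
    rw [← mul_assoc]
    exact mul_mul_mem_cellSpan π _ _ _

/-- A family of idempotents, pairwise inequivalent, each zero or primitive with corner `ℂ`, which
generate the unit ideal. -/
structure IsCellSystem (π : ι → A) : Prop where
  idem : ∀ k, π k * π k = π k
  full : 1 ∈ cellSpan π
  orth : ∀ j k, j ≠ k → ∀ x, π j * x * π k = 0
  corner : ∀ k x, ∃ c : ℂ, π k * x * π k = c • π k

end CellSystem

section JonesWenzlIdeal

variable {B : Type*} [Ring B] [Algebra ℂ B]

/-- Each correction term of the recursion contains a generator, so the Jones-Wenzl element is `1`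
modulo any two-sided ideal containing the generators involved. -/
theorem one_sub_jonesWenzl_mem {δ : ℂ} {e : ℕ → B} {n : ℕ} (I : Submodule ℂ B)
    (hl : ∀ a, ∀ x ∈ I, a * x ∈ I) (hr : ∀ a, ∀ x ∈ I, x * a ∈ I)
    (he : ∀ i, i + 1 < n → e i ∈ I) : 1 - jonesWenzl δ e n ∈ I := by
  induction n with
  | zero => simp [jonesWenzl_zero]
  | succ n ih =>
    cases n with
    | zero => simp [jonesWenzl_one]
    | succ n =>
      rw [jonesWenzl_succ_succ, sub_sub_eq_add_sub, add_sub_right_comm]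
      exact add_mem (ih fun i hi => he i (by omega))
        (I.smul_mem _ (hr _ _ (hl _ _ (he n (by omega)))))

end JonesWenzlIdeal

/-! ### The cell system of the Temperley-Lieb algebra -/

/-- The idempotent of `TL_m` belonging to the standard module with `k` through-lines (zero if
there is no such module). -/
def proj (δ : ℂ) : (m : ℕ) → ℕ → TL δ m
  | 0, k => if k = 0 then 1 else 0
  | 1, k => if k = 1 then 1 else 0
  | m + 2, k => if k = m + 2 then jonesWenzl δ (gen' δ (m + 2)) (m + 2)
      else δ⁻¹ • (inclLeft δ m 2 (proj δ m k) * gen' δ (m + 2) m)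

theorem proj_self (δ : ℂ) (m : ℕ) : proj δ m m = jonesWenzl δ (gen' δ m) m := by
  match m with
  | 0 => simp [proj, jonesWenzl_zero]
  | 1 => simp [proj, jonesWenzl_one]
  | m + 2 => simp [proj]

theorem proj_of_ne (δ : ℂ) {m k : ℕ} (h : k ≠ m + 2) :
    proj δ (m + 2) k = δ⁻¹ • (inclLeft δ m 2 (proj δ m k) * gen' δ (m + 2) m) := by
  rw [proj, if_neg h]

theorem proj_of_lt (δ : ℂ) {m k : ℕ} (h : m < k) : proj δ m k = 0 := by
  induction m using Nat.twoStepInduction with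
  | zero => rw [proj, if_neg (by omega)]
  | one => rw [proj, if_neg (by omega)]
  | more m ih _ => rw [proj_of_ne δ (by omega), ih (by omega), map_zero, zero_mul, smul_zero]

theorem proj_self_mul_gen' {δ : ℂ} (hu : ∀ n, 0 < n → quantumNat δ n ≠ 0) {m i : ℕ}
    (hi : i + 1 < m) : proj δ m m * gen' δ m i = 0 := by
  rw [proj_self]
  exact ((isTLSeq_gen' δ m).jonesWenzl_props hu m le_rfl).2.2 i hi

theorem gen'_mul_proj_self {δ : ℂ} (hu : ∀ n, 0 < n → quantumNat δ n ≠ 0) {m i : ℕ}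
    (hi : i + 1 < m) : gen' δ m i * proj δ m m = 0 := by
  rw [proj_self]
  exact ((isTLSeq_gen' δ m).jonesWenzl_props hu m le_rfl).2.1 i hi

/-- All generators annihilate the Jones-Wenzl projector, so the algebra acts on it through scalars.
-/
theorem exists_proj_self_mul {δ : ℂ} (hu : ∀ n, 0 < n → quantumNat δ n ≠ 0) {m : ℕ}
    (x : TL δ m) : ∃ c : ℂ, proj δ m m * x = c • proj δ m m := by
  induction x using TL.induction with
  | hs c => exact ⟨c, by rw [← Algebra.commutes, ← Algebra.smul_def]⟩
  | hg i hi => exact ⟨0, by rw [proj_self_mul_gen' hu hi, zero_smul]⟩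
  | ha x y hx hy =>
    obtain ⟨c, hc⟩ := hx
    obtain ⟨d, hd⟩ := hy
    exact ⟨c + d, by rw [mul_add, hc, hd, add_smul]⟩
  | hm x y hx hy =>
    obtain ⟨c, hc⟩ := hx
    obtain ⟨d, hd⟩ := hy
    exact ⟨c * d, by rw [← mul_assoc, hc, smul_mul_assoc, hd, smul_smul]⟩

theorem exists_mul_proj_self {δ : ℂ} (hu : ∀ n, 0 < n → quantumNat δ n ≠ 0) {m : ℕ}
    (x : TL δ m) : ∃ c : ℂ, x * proj δ m m = c • proj δ m m := by
  induction x using TL.induction with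
  | hs c => exact ⟨c, by rw [← Algebra.smul_def]⟩
  | hg i hi => exact ⟨0, by rw [gen'_mul_proj_self hu hi, zero_smul]⟩
  | ha x y hx hy =>
    obtain ⟨c, hc⟩ := hx
    obtain ⟨d, hd⟩ := hy
    exact ⟨c + d, by rw [add_mul, hc, hd, add_smul]⟩
  | hm x y hx hy =>
    obtain ⟨c, hc⟩ := hx
    obtain ⟨d, hd⟩ := hy
    exact ⟨d * c, by rw [mul_assoc, hd, mul_smul_comm, hc, smul_smul]⟩

theorem proj_idem {δ : ℂ} (hδ : δ ≠ 0) (hu : ∀ n, 0 < n → quantumNat δ n ≠ 0) (m k : ℕ) :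
    proj δ m k * proj δ m k = proj δ m k := by
  induction m using Nat.twoStepInduction with
  | zero => rw [proj]; split_ifs <;> simp
  | one => rw [proj]; split_ifs <;> simp
  | more m ih _ =>
    by_cases hk : k = m + 2
    · rw [hk, proj_self]
      exact ((isTLSeq_gen' δ (m + 2)).jonesWenzl_props hu _ le_rfl).1
    · have hc := (commute_inclLeft_gen' δ m (proj δ m k)).eq
      have hs := (isTLSeq_gen' δ (m + 2)).sq m (by omega)
      rw [proj_of_ne δ hk, smul_mul_smul_comm, mul_assoc, ← mul_assoc (gen' δ (m + 2) m), ← hc,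
        mul_assoc, hs, ← mul_assoc, ← map_mul, ih, mul_smul_comm, smul_smul, mul_assoc,
        inv_mul_cancel₀ hδ, mul_one]

/-- The last generator commutes with `TL δ m`, so it can be moved next to the idempotent in `a *
proj δ m k * b`, turning it into `δ • proj δ (m + 2) k`. -/
theorem inclLeft_mul_gen'_mem_cellSpan {δ : ℂ} (hδ : δ ≠ 0) {m : ℕ} {x : TL δ m}
    (hx : x ∈ cellSpan (proj δ m)) :
    inclLeft δ m 2 x * gen' δ (m + 2) m ∈ cellSpan (proj δ (m + 2)) := by
  induction hx using Submodule.span_induction with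
  | zero => simp
  | add x y _ _ hx hy => rw [map_add, add_mul]; exact add_mem hx hy
  | smul c x _ hx => rw [map_smul, smul_mul_assoc]; exact Submodule.smul_mem _ _ hx
  | mem x hx =>
    obtain ⟨⟨a, k, b⟩, rfl⟩ := hx
    -- At this index `proj δ (m + 2) k` is not built from `proj δ m k`, but the latter is zero.
    by_cases hk : k = m + 2
    · simp [proj_of_lt δ (show m < k by omega)]
    · have h : inclLeft δ m 2 (a * proj δ m k * b) * gen' δ (m + 2) m =
          δ • (inclLeft δ m 2 a * proj δ (m + 2) k * inclLeft δ m 2 b) := by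
        rw [proj_of_ne δ hk, mul_smul_comm, smul_mul_assoc, smul_smul, mul_inv_cancel₀ hδ, one_smul,
          map_mul, map_mul, mul_assoc, (commute_inclLeft_gen' δ m b).eq]
        simp only [mul_assoc]
      simp only [h]
      exact Submodule.smul_mem _ _ (mul_mul_mem_cellSpan _ _ _ _)

/-- The case `m` puts the last generator of `TL δ (m + 2)` into the ideal. The relations `e i * e (i
+ 1) * e i = e i` spread this to all generators, and modulo these `1` equals the Jones-Wenzl
projector, itself a member of the family. -/
theorem one_mem_cellSpan_proj {δ : ℂ} (hδ : δ ≠ 0) (m : ℕ) :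
    1 ∈ cellSpan (proj δ m) := by
  induction m using Nat.twoStepInduction with
  | zero => simpa [proj] using mem_cellSpan (proj δ 0) 0
  | one => simpa [proj] using mem_cellSpan (proj δ 1) 1
  | more m ih _ =>
    have hlast : gen' δ (m + 2) m ∈ cellSpan (proj δ (m + 2)) := by
      simpa using inclLeft_mul_gen'_mem_cellSpan hδ ih
    have hgen : ∀ d i, i + d = m → gen' δ (m + 2) i ∈ cellSpan (proj δ (m + 2)) := by
      intro d
      induction d with
      | zero => intro i hi; obtain rfl : i = m := hi; exact hlast
      | succ d ihd =>
        intro i hi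
        rw [← (isTLSeq_gen' δ (m + 2)).up i (by omega)]
        exact mul_mem_cellSpan_right _ _ (mul_mem_cellSpan_left _ _ (ihd (i + 1) (by omega)))
    have h := one_sub_jonesWenzl_mem (δ := δ) (e := gen' δ (m + 2)) (n := m + 2)
      (cellSpan (proj δ (m + 2))) (fun a x hx => mul_mem_cellSpan_left _ a hx)
      (fun a x hx => mul_mem_cellSpan_right _ a hx) (fun i hi => hgen (m - i) i (by omega))
    rw [← proj_self] at h
    simpa using add_mem h (mem_cellSpan (proj δ (m + 2)) (m + 2))

/-- The Jones-Wenzl member sees only scalars and is killed by the generator contained in every other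
member. Between two other members, the sandwich property reduces the claim to `TL δ m`. -/
theorem proj_mul_mul_proj {δ : ℂ} (hu : ∀ n, 0 < n → quantumNat δ n ≠ 0) (m : ℕ) :
    (∀ j k, j ≠ k → ∀ x, proj δ m j * x * proj δ m k = 0) ∧
      ∀ k x, ∃ c : ℂ, proj δ m k * x * proj δ m k = c • proj δ m k := by
  have hdiag : ∀ m x, ∃ c : ℂ, proj δ m m * x * proj δ m m = c • proj δ m m := by
    intro m x
    obtain ⟨c, hc⟩ := exists_proj_self_mul hu x
    obtain ⟨d, hd⟩ := exists_proj_self_mul hu (proj δ m m)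
    exact ⟨c * d, by rw [hc, smul_mul_assoc, hd, smul_smul]⟩
  induction m using Nat.twoStepInduction with
  | zero =>
    refine ⟨fun j k hjk x => ?_, fun k x => ?_⟩
    · by_cases hj : j = 0
      · rw [proj_of_lt δ (show 0 < k by omega), mul_zero]
      · rw [proj_of_lt δ (show 0 < j by omega), zero_mul, zero_mul]
    · by_cases hk : k = 0
      · subst hk; exact hdiag 0 x
      · exact ⟨0, by rw [proj_of_lt δ (show 0 < k by omega), mul_zero, smul_zero]⟩
  | one =>
    have h0 : ∀ k, k ≠ 1 → proj δ 1 k = 0 := fun k hk => by rw [proj, if_neg hk]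
    refine ⟨fun j k hjk x => ?_, fun k x => ?_⟩
    · by_cases hj : j = 1
      · rw [h0 k (by omega), mul_zero]
      · rw [h0 j hj, zero_mul, zero_mul]
    · by_cases hk : k = 1
      · subst hk; exact hdiag 1 x
      · exact ⟨0, by rw [h0 k hk, mul_zero, smul_zero]⟩
  | more m ih _ =>
    obtain ⟨ih1, ih2⟩ := ih
    have hsand : ∀ j k x, j ≠ m + 2 → k ≠ m + 2 → ∃ y, proj δ (m + 2) j * x * proj δ (m + 2) k =
        (δ⁻¹ * δ⁻¹) • (inclLeft δ m 2 (proj δ m j * y * proj δ m k) * gen' δ (m + 2) m) := by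
      intro j k x hj hk
      obtain ⟨y, hy⟩ := exists_gen'_mul_mul_gen' δ m x
      refine ⟨y, ?_⟩
      have hc := (commute_inclLeft_gen' δ m (proj δ m k)).eq
      rw [proj_of_ne δ hj, proj_of_ne δ hk, smul_mul_assoc, smul_mul_smul_comm, hc]
      congr 1
      calc _ = inclLeft δ m 2 (proj δ m j) * (gen' δ (m + 2) m * x * gen' δ (m + 2) m) *
            inclLeft δ m 2 (proj δ m k) := by simp only [mul_assoc]
        _ = _ := by rw [hy, map_mul, map_mul, mul_assoc, mul_assoc, ← hc]; simp only [mul_assoc]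
    refine ⟨fun j k hjk x => ?_, fun k x => ?_⟩
    · by_cases hj : j = m + 2
      · obtain ⟨c, hc⟩ := exists_proj_self_mul hu (x * inclLeft δ m 2 (proj δ m k))
        rw [hj, proj_of_ne δ (show k ≠ m + 2 by omega), mul_smul_comm, mul_assoc,
          ← mul_assoc x, ← mul_assoc, hc, smul_mul_assoc, proj_self_mul_gen' hu (by omega),
          smul_zero, smul_zero]
      · by_cases hk : k = m + 2
        · obtain ⟨c, hc⟩ := exists_mul_proj_self hu x
          rw [hk, proj_of_ne δ hj, mul_assoc, hc, mul_smul_comm, smul_mul_assoc, mul_assoc,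
            gen'_mul_proj_self hu (by omega), mul_zero, smul_zero, smul_zero]
        · obtain ⟨y, hy⟩ := hsand j k x hj hk
          rw [hy, ih1 j k hjk, map_zero, zero_mul, smul_zero]
    · by_cases hk : k = m + 2
      · rw [hk]; exact hdiag _ x
      · obtain ⟨y, hy⟩ := hsand k k x hk hk
        obtain ⟨c, hc⟩ := ih2 k y
        refine ⟨δ⁻¹ * c, ?_⟩
        rw [hy, hc, map_smul, smul_mul_assoc, proj_of_ne δ hk, smul_smul, smul_smul]
        congr 1
        ring

theorem isCellSystem_proj {δ : ℂ} (hδ : δ ≠ 0) (hu : ∀ n, 0 < n → quantumNat δ n ≠ 0) (m : ℕ) :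
    IsCellSystem (proj δ m) where
  idem := proj_idem hδ hu m
  full := one_mem_cellSpan_proj hδ m
  orth := (proj_mul_mul_proj hu m).1
  corner := (proj_mul_mul_proj hu m).2

theorem IsCellSystem.tensor {A B : Type*} [Ring A] [Algebra ℂ A] [Ring B] [Algebra ℂ B]
    {ι κ : Type*} {π : ι → A} {σ : κ → B} (hπ : IsCellSystem π) (hσ : IsCellSystem σ) :
    IsCellSystem (A := A ⊗[ℂ] B) fun p : ι × κ => π p.1 ⊗ₜ[ℂ] σ p.2 where
  idem k := by rw [Algebra.TensorProduct.tmul_mul_tmul, hπ.idem, hσ.idem]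
  full := by
    have h : ∀ x ∈ cellSpan π, ∀ y ∈ cellSpan σ,
        x ⊗ₜ[ℂ] y ∈ cellSpan fun p : ι × κ => π p.1 ⊗ₜ[ℂ] σ p.2 := by
      intro x hx y hy
      induction hx using Submodule.span_induction with
      | zero => simp
      | add a b _ _ ha hb => rw [TensorProduct.add_tmul]; exact add_mem ha hb
      | smul c a _ ha => rw [← TensorProduct.smul_tmul']; exact Submodule.smul_mem _ _ ha
      | mem x hx =>
        induction hy using Submodule.span_induction with
        | zero => simp
        | add a b _ _ ha hb => rw [TensorProduct.tmul_add]; exact add_mem ha hb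
        | smul c a _ ha => rw [TensorProduct.tmul_smul]; exact Submodule.smul_mem _ _ ha
        | mem y hy =>
          obtain ⟨⟨a, k, b⟩, rfl⟩ := hx
          obtain ⟨⟨a', k', b'⟩, rfl⟩ := hy
          have := mul_mul_mem_cellSpan (fun p : ι × κ => π p.1 ⊗ₜ[ℂ] σ p.2)
            (a ⊗ₜ[ℂ] a') (b ⊗ₜ[ℂ] b') (k, k')
          simpa only [Algebra.TensorProduct.tmul_mul_tmul] using this
    exact h 1 hπ.full 1 hσ.full
  orth j k hjk x := by
    induction x using TensorProduct.induction_on with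
    | zero => simp
    | add x y hx hy => rw [mul_add, add_mul, hx, hy, add_zero]
    | tmul a b =>
      rw [Algebra.TensorProduct.tmul_mul_tmul, Algebra.TensorProduct.tmul_mul_tmul]
      by_cases h : j.1 = k.1
      · rw [hσ.orth _ _ fun h' => hjk (Prod.ext h h'), TensorProduct.tmul_zero]
      · rw [hπ.orth _ _ h, TensorProduct.zero_tmul]
  corner k x := by
    induction x using TensorProduct.induction_on with
    | zero => exact ⟨0, by simp⟩
    | add x y hx hy =>
      obtain ⟨c, hc⟩ := hx
      obtain ⟨d, hd⟩ := hy
      exact ⟨c + d, by rw [mul_add, add_mul, hc, hd, add_smul]⟩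
    | tmul a b =>
      obtain ⟨c, hc⟩ := hπ.corner k.1 a
      obtain ⟨d, hd⟩ := hσ.corner k.2 b
      exact ⟨c * d, by rw [Algebra.TensorProduct.tmul_mul_tmul,
        Algebra.TensorProduct.tmul_mul_tmul, hc, hd, TensorProduct.smul_tmul_smul]⟩

/-! ### Representations of an algebra with a cell system -/

section Representations

variable {A : Type*} [Ring A] [Algebra ℂ A] {ι : Type*} {π : ι → A}
  {M : Type*} [AddCommGroup M] [Module ℂ M] {M' : Type*} [AddCommGroup M'] [Module ℂ M']
  {ρ : A →ₐ[ℂ] Module.End ℂ M} {ρ' : A →ₐ[ℂ] Module.End ℂ M'}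

/-- The space of intertwiners between two representations. -/
def intertwiners (ρ : A →ₐ[ℂ] Module.End ℂ M) (ρ' : A →ₐ[ℂ] Module.End ℂ M') :
    Submodule ℂ (M →ₗ[ℂ] M') where
  carrier := {f | ∀ a m, f (ρ a m) = ρ' a (f m)}
  zero_mem' a m := by simp
  add_mem' hf hg a m := by simp [hf a m, hg a m]
  smul_mem' c f hf a m := by simp [hf a m]

/-- Intertwiners preserve the images of elements of the algebra. -/
def restrictRange (ρ : A →ₐ[ℂ] Module.End ℂ M) (ρ' : A →ₐ[ℂ] Module.End ℂ M') (a : A) :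
    intertwiners ρ ρ' →ₗ[ℂ] (LinearMap.range (ρ a) →ₗ[ℂ] LinearMap.range (ρ' a)) where
  toFun f := f.1.restrict (by
    rintro _ ⟨m, rfl⟩
    exact ⟨f.1 m, (f.2 a m).symm⟩)
  map_add' f g := rfl
  map_smul' c f := rfl

theorem restrictRange_apply (a : A) (f : intertwiners ρ ρ') (m : LinearMap.range (ρ a)) :
    (restrictRange ρ ρ' a f m : M') = f.1 m := rfl

/-- The corners generate the representation, since `1` is a combination of products `a * π k * b`.
-/
theorem IsCellSystem.intertwiner_ext (hπ : IsCellSystem π) {f g : M →ₗ[ℂ] M'}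
    (hf : f ∈ intertwiners ρ ρ') (hg : g ∈ intertwiners ρ ρ')
    (h : ∀ k m, f (ρ (π k) m) = g (ρ (π k) m)) : f = g := by
  ext m
  have key : ∀ x ∈ cellSpan π, f (ρ x m) = g (ρ x m) := by
    intro x hx
    induction hx using Submodule.span_induction with
    | zero => simp
    | add a b _ _ ha hb => simp [ha, hb]
    | smul c a _ ha => simp [ha]
    | mem x hx =>
      obtain ⟨⟨a, k, b⟩, rfl⟩ := hx
      simp only [map_mul, Module.End.mul_apply]
      rw [hf, hg, h]
  simpa using key 1 hπ.full

/-- Linear maps between corners need no compatibility condition: the algebra induces only scalars on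
each corner and nothing between different corners. -/
theorem IsCellSystem.exists_intertwiner (hπ : IsCellSystem π)
    (θ : ∀ k, LinearMap.range (ρ (π k)) →ₗ[ℂ] LinearMap.range (ρ' (π k))) :
    ∃ f : intertwiners ρ ρ', ∀ k, restrictRange ρ ρ' (π k) f = θ k := by
  classical
  obtain ⟨c, hc⟩ := Finsupp.mem_span_range_iff_exists_finsupp.1 hπ.full
  let T : ι → M →ₗ[ℂ] M' := fun k =>
    (LinearMap.range (ρ' (π k))).subtype ∘ₗ θ k ∘ₗ (ρ (π k)).rangeRestrict
  have hT1 : ∀ k m, T k (ρ (π k) m) = T k m := by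
    intro k m
    simp only [T, LinearMap.comp_apply]
    congr 2
    ext1
    change ρ (π k) (ρ (π k) m) = ρ (π k) m
    rw [← Module.End.mul_apply, ← map_mul, hπ.idem]
  have hT2 : ∀ k m, ρ' (π k) (T k m) = T k m := by
    intro k m
    obtain ⟨y, hy⟩ := (θ k ((ρ (π k)).rangeRestrict m)).2
    change ρ' (π k) (θ k ((ρ (π k)).rangeRestrict m) : M') = θ k ((ρ (π k)).rangeRestrict m)
    rw [← hy, ← Module.End.mul_apply, ← map_mul, hπ.idem]
  -- The element `π l * x * π k` is a multiple of `π l` if `l = k` and zero otherwise, so the family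
  -- `T` respects it.
  have hT3 : ∀ l k x m, ρ' (π l) (ρ' x (T k m)) = T l (ρ x (ρ (π k) m)) := by
    intro l k x m
    have e1 : ρ' (π l) (ρ' x (T k m)) = ρ' (π l * x * π k) (T k m) := by
      rw [map_mul, map_mul, Module.End.mul_apply, Module.End.mul_apply, hT2]
    have e2 : T l (ρ x (ρ (π k) m)) = T l (ρ (π l * x * π k) m) := by
      rw [map_mul, map_mul, Module.End.mul_apply, Module.End.mul_apply, hT1]
    rw [e1, e2]
    by_cases h : l = k
    · subst h
      obtain ⟨d, hd⟩ := hπ.corner l x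
      rw [hd, map_smul, map_smul, LinearMap.smul_apply, LinearMap.smul_apply, map_smul, hT1, hT2]
    · rw [hπ.orth _ _ h]
      simp
  -- This formula is forced: it is what an intertwiner extending the `θ k` must give on the
  -- decomposition of `1`.
  let F : M →ₗ[ℂ] M' := c.sum fun t r => r • (ρ' t.1 ∘ₗ T t.2.1 ∘ₗ ρ t.2.2)
  have hF : ∀ m, F m = c.sum fun t r => r • ρ' t.1 (T t.2.1 (ρ t.2.2 m)) := by
    intro m
    simp [F, Finsupp.sum]
  have hone : ∀ m, (c.sum fun t r => r • ρ t.1 (ρ (π t.2.1) (ρ t.2.2 m))) = m := fun m => by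
    simpa [Finsupp.sum, map_sum] using congrArg (fun z => ρ z m) hc
  have hone' : ∀ m, (c.sum fun t r => r • ρ' t.1 (ρ' (π t.2.1) (ρ' t.2.2 m))) = m := fun m => by
    simpa [Finsupp.sum, map_sum] using congrArg (fun z => ρ' z m) hc
  have hTF : ∀ l x m, ρ' (π l) (ρ' x (F m)) = T l (ρ x m) := by
    intro l x m
    conv_rhs => rw [← hone m]
    rw [hF]
    simp only [Finsupp.sum, map_sum, map_smul]
    refine Finset.sum_congr rfl fun t _ => ?_
    rw [← Module.End.mul_apply (ρ' x), ← map_mul, hT3, map_mul, Module.End.mul_apply]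
  -- Decomposing `1` on the target side reduces equivariance to `hTF`.
  have hFint : F ∈ intertwiners ρ ρ' := by
    intro x m
    rw [← hone' (ρ' x (F m)), hF]
    simp only [Finsupp.sum]
    refine Finset.sum_congr rfl fun t _ => ?_
    rw [← Module.End.mul_apply (ρ' t.2.2), ← map_mul, hTF, map_mul, Module.End.mul_apply]
  refine ⟨⟨F, hFint⟩, fun k => ?_⟩
  ext ⟨_, m, rfl⟩
  rw [restrictRange_apply]
  change F (ρ (π k) m) = _
  have h := hTF k 1 m
  rw [map_one, map_one, Module.End.one_apply, Module.End.one_apply] at h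
  rw [hFint, h]
  rfl

/-- Two representations whose corners are isomorphic are isomorphic. -/
theorem IsCellSystem.exists_equiv (hπ : IsCellSystem π)
    (θ : ∀ k, LinearMap.range (ρ (π k)) ≃ₗ[ℂ] LinearMap.range (ρ' (π k))) :
    ∃ f : M ≃ₗ[ℂ] M', ∀ a m, f (ρ a m) = ρ' a (f m) := by
  obtain ⟨f, hf⟩ := hπ.exists_intertwiner fun k => (θ k).toLinearMap
  obtain ⟨g, hg⟩ := hπ.exists_intertwiner fun k => (θ k).symm.toLinearMap
  have hf' : ∀ k m, f.1 (ρ (π k) m) = θ k ⟨ρ (π k) m, m, rfl⟩ := fun k m => by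
    rw [← LinearEquiv.coe_coe, ← hf k, restrictRange_apply]
  have hg' : ∀ k m, g.1 (ρ' (π k) m) = (θ k).symm ⟨ρ' (π k) m, m, rfl⟩ := fun k m => by
    rw [← LinearEquiv.coe_coe, ← hg k, restrictRange_apply]
  have hgf : ∀ k (y : LinearMap.range (ρ' (π k))), g.1 y = (θ k).symm y := by
    rintro k ⟨_, m, rfl⟩; exact hg' k m
  have hfg : ∀ k (y : LinearMap.range (ρ (π k))), f.1 y = θ k y := by
    rintro k ⟨_, m, rfl⟩; exact hf' k m
  have h1 : g.1 ∘ₗ f.1 = LinearMap.id := by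
    refine hπ.intertwiner_ext (ρ := ρ) (ρ' := ρ) (fun a m => ?_) (fun a m => rfl) fun k m => ?_
    · rw [LinearMap.comp_apply, f.2, g.2]; rfl
    · rw [LinearMap.comp_apply, hf', hgf, LinearEquiv.symm_apply_apply]; rfl
  have h2 : f.1 ∘ₗ g.1 = LinearMap.id := by
    refine hπ.intertwiner_ext (ρ := ρ') (ρ' := ρ') (fun a m => ?_) (fun a m => rfl) fun k m => ?_
    · rw [LinearMap.comp_apply, g.2, f.2]; rfl
    · rw [LinearMap.comp_apply, hg', hfg, LinearEquiv.apply_symm_apply]; rfl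
  exact ⟨LinearEquiv.ofLinearMap f.1 g.1 h2 h1, f.2⟩

/-- If the representations have only one corner in common, an intertwiner is the same thing as a
linear map between these corners. -/
def IsCellSystem.intertwinersEquiv (hπ : IsCellSystem π) (ρ : A →ₐ[ℂ] Module.End ℂ M)
    (ρ' : A →ₐ[ℂ] Module.End ℂ M') (j : ι)
    (h : ∀ k, k ≠ j →
      Subsingleton (LinearMap.range (ρ (π k)) →ₗ[ℂ] LinearMap.range (ρ' (π k)))) :
    intertwiners ρ ρ' ≃ₗ[ℂ] (LinearMap.range (ρ (π j)) →ₗ[ℂ] LinearMap.range (ρ' (π j))) :=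
  LinearEquiv.ofBijective (restrictRange ρ ρ' (π j)) (by
    classical
    constructor
    · intro f g hfg
      refine Subtype.ext (hπ.intertwiner_ext f.2 g.2 fun k m => ?_)
      have h1 : restrictRange ρ ρ' (π k) f = restrictRange ρ ρ' (π k) g := by
        by_cases hk : k = j
        · subst hk; exact hfg
        · exact (h k hk).elim _ _
      exact congrArg Subtype.val (DFunLike.congr_fun h1 ⟨ρ (π k) m, m, rfl⟩)
    · intro θ
      obtain ⟨f, hf⟩ := hπ.exists_intertwiner (ρ := ρ) (ρ' := ρ')
        (Function.update (fun k => 0) j θ)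
      exact ⟨f, by rw [hf j, Function.update_self]⟩)

/-- Traces are linear and cyclic in the algebra element, which makes dimensions of corners
computable. -/
theorem finrank_range_eq_trace [Module.Finite ℂ M] (hπ : IsCellSystem π) (k : ι) :
    (Module.finrank ℂ (LinearMap.range (ρ (π k))) : ℂ) = LinearMap.trace ℂ M (ρ (π k)) := by
  have hp : LinearMap.IsProj (LinearMap.range (ρ (π k))) (ρ (π k)) :=
    ⟨fun x => ⟨x, rfl⟩, by
      rintro _ ⟨m, rfl⟩
      rw [← Module.End.mul_apply, ← map_mul, hπ.idem]⟩
  exact hp.trace.symm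

end Representations

/-! ### Adding and removing sites of link states -/

theorem card_fixed_succ {N : ℕ} (f : Fin (N + 1) → Fin (N + 1)) :
    (Finset.univ.filter fun x => f x = x).card =
      (Finset.univ.filter fun x : Fin N => f x.castSucc = x.castSucc).card +
        if f (Fin.last N) = Fin.last N then 1 else 0 := by
  simp only [Finset.card_filter, Fin.sum_univ_castSucc]

namespace LinkState

variable {N k : ℕ}

theorem partner_injective : Function.Injective (partner : LinkState N k → Fin N → Fin N) :=
  fun _ _ h => LinkState.ext h

instance : Finite (LinkState N k) := Finite.of_injective _ partner_injective

/-- Add a through-line at the right end. -/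
def addThrough (s : LinkState N k) : LinkState (N + 1) (k + 1) where
  partner := Fin.lastCases (Fin.last N) fun x => (s.partner x).castSucc
  invol a := by
    induction a using Fin.lastCases with
    | last => simp
    | cast a => simp [s.invol]
  noncrossing a b hab hb := by
    induction a using Fin.lastCases with
    | last => simp at hb; omega
    | cast a =>
      induction b using Fin.lastCases with
      | last => simp [Fin.lt_def] at hb; omega
      | cast b => simpa using s.noncrossing a b (by simpa using hab) (by simpa using hb)
  uncovered a b hab hb := by
    induction a using Fin.lastCases with
    | last => simp at hb; omega
    | cast a =>
      induction b using Fin.lastCases with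
      | last => simp [Fin.lt_def] at hb; omega
      | cast b => simpa using s.uncovered a b (by simpa using hab) (by simpa using hb)
  card_through := by
    rw [card_fixed_succ]
    simp [s.card_through]

theorem addThrough_last (s : LinkState N k) :
    s.addThrough.partner (Fin.last N) = Fin.last N := by simp [addThrough]

theorem addThrough_castSucc (s : LinkState N k) (x : Fin N) :
    s.addThrough.partner x.castSucc = (s.partner x).castSucc := by simp [addThrough]

theorem exists_addThrough (s : LinkState (N + 1) (k + 1))
    (h : s.partner (Fin.last N) = Fin.last N) : ∃ t : LinkState N k, t.addThrough = s := by
  have hne : ∀ x : Fin N, s.partner x.castSucc ≠ Fin.last N := fun x hx => by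
    have := congrArg s.partner hx
    rw [s.invol, h] at this
    exact (Fin.castSucc_lt_last x).ne this
  let f : Fin N → Fin N := fun x => (s.partner x.castSucc).castPred (hne x)
  have hf : ∀ x, (f x).castSucc = s.partner x.castSucc := fun x => Fin.castSucc_castPred _ _
  have hlt : ∀ {x y : Fin N}, x < y ↔ x.castSucc < y.castSucc := Fin.castSucc_lt_castSucc_iff.symm
  have heq : ∀ {x y : Fin N}, x = y ↔ x.castSucc = y.castSucc := Fin.castSucc_inj.symm
  have hcard := s.card_through
  rw [card_fixed_succ, if_pos h, Nat.add_right_cancel_iff] at hcard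
  refine ⟨⟨f, fun a => ?_, fun a b hab hb => ?_, fun a b hab hb => ?_, ?_⟩, ?_⟩
  · rw [heq, hf, hf, s.invol]
  · rw [hlt, hf] at hb
    rw [hlt, hf, hf]
    exact s.noncrossing _ _ (hlt.1 hab) hb
  · rw [hlt, hf] at hb
    rw [Ne, heq, hf]
    exact s.uncovered _ _ (hlt.1 hab) hb
  · rw [← hcard]
    congr 1
    ext x
    simp only [Finset.mem_filter, Finset.mem_univ, true_and]
    rw [heq, hf]
  · ext1
    funext x
    induction x using Fin.lastCases with
    | last => rw [addThrough_last, h]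
    | cast x => rw [addThrough_castSucc]; exact hf x

theorem addThrough_injective : Function.Injective (addThrough : LinkState N k → _) := by
  intro s t h
  ext x : 2
  have h1 := congrArg (fun u => partner u x.castSucc) h
  simp only [addThrough_castSucc] at h1
  exact Fin.castSucc_injective _ h1

/-- Add an arc joining two new sites at the right end. -/
def addArc (s : LinkState N k) : LinkState (N + 2) k where
  partner := Fin.lastCases (Fin.last N).castSucc
    (Fin.lastCases (Fin.last (N + 1)) fun x => (s.partner x).castSucc.castSucc)
  invol a := by
    induction a using Fin.lastCases with
    | last => simp
    | cast a =>
      induction a using Fin.lastCases with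
      | last => simp
      | cast a => simp [s.invol]
  noncrossing a b hab hb := by
    induction a using Fin.lastCases with
    | last => simp [Fin.lt_def] at hab hb; omega
    | cast a =>
      induction a using Fin.lastCases with
      | last => simp [Fin.lt_def] at hab hb; omega
      | cast a =>
        induction b using Fin.lastCases with
        | last => simp [Fin.lt_def] at hb; omega
        | cast b =>
          induction b using Fin.lastCases with
          | last => simp [Fin.lt_def] at hb; omega
          | cast b => simpa using s.noncrossing a b (by simpa using hab) (by simpa using hb)
  uncovered a b hab hb := by
    induction a using Fin.lastCases with
    | last => simp [Fin.lt_def] at hab hb; omega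
    | cast a =>
      induction a using Fin.lastCases with
      | last => simp [Fin.lt_def] at hab hb; omega
      | cast a =>
        induction b using Fin.lastCases with
        | last => simp [Fin.lt_def] at hb; omega
        | cast b =>
          induction b using Fin.lastCases with
          | last => simp [Fin.lt_def] at hb; omega
          | cast b => simpa using s.uncovered a b (by simpa using hab) (by simpa using hb)
  card_through := by
    simp only [Finset.card_filter, Fin.sum_univ_castSucc, Fin.lastCases_castSucc,
      Fin.lastCases_last, (Fin.castSucc_lt_last _).ne, (Fin.castSucc_lt_last _).ne', if_false,
      add_zero, Fin.castSucc_inj]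
    rw [← Finset.card_filter, s.card_through]

theorem addArc_last (s : LinkState N k) :
    s.addArc.partner (Fin.last (N + 1)) = (Fin.last N).castSucc := by simp [addArc]

theorem addArc_castSucc_last (s : LinkState N k) :
    s.addArc.partner (Fin.last N).castSucc = Fin.last (N + 1) := by simp [addArc]

theorem addArc_castSucc_castSucc (s : LinkState N k) (x : Fin N) :
    s.addArc.partner x.castSucc.castSucc = (s.partner x).castSucc.castSucc := by simp [addArc]

theorem addArc_injective : Function.Injective (addArc : LinkState N k → _) := by
  intro s t h
  ext x : 2
  have h1 := congrArg (fun u => partner u x.castSucc.castSucc) h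
  simp only [addArc_castSucc_castSucc] at h1
  exact Fin.castSucc_injective _ (Fin.castSucc_injective _ h1)

theorem exists_addArc (s : LinkState (N + 2) k)
    (h : s.partner (Fin.last N).castSucc = Fin.last (N + 1)) :
    ∃ t : LinkState N k, t.addArc = s := by
  have h' : s.partner (Fin.last (N + 1)) = (Fin.last N).castSucc := by rw [← h, s.invol]
  have hne : ∀ x : Fin N, ∃ y : Fin N, y.castSucc.castSucc = s.partner x.castSucc.castSucc := by
    intro x
    have h1 : s.partner x.castSucc.castSucc ≠ Fin.last (N + 1) := fun hx => by
      have := congrArg s.partner hx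
      rw [s.invol, h'] at this
      simp [Fin.ext_iff] at this
      omega
    have h2 : (s.partner x.castSucc.castSucc).castPred h1 ≠ Fin.last N := fun hx => by
      have := congrArg (fun y => s.partner y.castSucc) hx
      simp only [Fin.castSucc_castPred] at this
      rw [s.invol, h] at this
      simp [Fin.ext_iff] at this
      omega
    exact ⟨Fin.castPred _ h2, by simp⟩
  choose f hf using hne
  have hlt : ∀ {x y : Fin N}, x < y ↔ x.castSucc.castSucc < y.castSucc.castSucc := by simp
  have heq : ∀ {x y : Fin N}, x = y ↔ x.castSucc.castSucc = y.castSucc.castSucc := by simp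
  have hcard := s.card_through
  simp only [Finset.card_filter, Fin.sum_univ_castSucc, h, h',
    (Fin.castSucc_lt_last _).ne, (Fin.castSucc_lt_last _).ne', if_false, add_zero] at hcard
  rw [← Finset.card_filter] at hcard
  refine ⟨⟨f, fun a => ?_, fun a b hab hb => ?_, fun a b hab hb => ?_, ?_⟩, ?_⟩
  · rw [heq, hf, hf, s.invol]
  · rw [hlt, hf] at hb
    rw [hlt, hf, hf]
    exact s.noncrossing _ _ (hlt.1 hab) hb
  · rw [hlt, hf] at hb
    rw [Ne, heq, hf]
    exact s.uncovered _ _ (hlt.1 hab) hb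
  · rw [← hcard]
    congr 1
    ext x
    simp only [Finset.mem_filter, Finset.mem_univ, true_and]
    rw [heq, hf]
  · ext1
    funext x
    induction x using Fin.lastCases with
    | last => rw [addArc_last, h']
    | cast x =>
      induction x using Fin.lastCases with
      | last => rw [addArc_castSucc_last, h]
      | cast x => rw [addArc_castSucc_castSucc]; exact hf x

/-- Cut the arc ending at the last site and remove that site. -/
def cutLast (s : LinkState (N + 1) k) (h : s.partner (Fin.last N) ≠ Fin.last N) :
    LinkState N (k + 1) where
  partner x := if hx : s.partner x.castSucc = Fin.last N then x
    else (s.partner x.castSucc).castPred hx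
  invol a := by
    by_cases ha : s.partner a.castSucc = Fin.last N
    · simp [ha]
    · have : a.castSucc ≠ Fin.last N := (Fin.castSucc_lt_last a).ne
      simp [ha, s.invol]
  noncrossing a b hab hb := by
    by_cases ha : s.partner a.castSucc = Fin.last N
    · simp [ha] at hb; omega
    · simp only [ha, dite_false] at hb ⊢
      have h1 := s.noncrossing a.castSucc b.castSucc hab hb
      by_cases hb' : s.partner b.castSucc = Fin.last N
      · exact absurd (hb' ▸ Fin.lt_last_iff_ne_last.2 ha) h1
      · simpa [hb'] using h1
  uncovered a b hab hb := by
    by_cases ha : s.partner a.castSucc = Fin.last N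
    · simp [ha] at hb; omega
    · simp only [ha, dite_false] at hb ⊢
      have h1 := s.noncrossing a.castSucc b.castSucc hab hb
      have h2 := s.uncovered a.castSucc b.castSucc hab hb
      by_cases hb' : s.partner b.castSucc = Fin.last N
      · exact absurd (hb' ▸ Fin.lt_last_iff_ne_last.2 ha) h1
      · simp only [hb', dite_false]
        exact fun e => h2 (by rw [← Fin.castSucc_inj, Fin.castSucc_castPred] at e; exact e)
  card_through := by
    have hcard := s.card_through
    rw [card_fixed_succ, if_neg h, add_zero] at hcard
    have e : (Finset.univ.filter fun x : Fin N => (if hx : s.partner x.castSucc = Fin.last N then x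
        else (s.partner x.castSucc).castPred hx) = x) =
        insert ((s.partner (Fin.last N)).castPred h)
          (Finset.univ.filter fun x : Fin N => s.partner x.castSucc = x.castSucc) := by
      ext x
      simp only [Finset.mem_filter, Finset.mem_univ, true_and, Finset.mem_insert]
      rw [← Fin.castSucc_inj (b := Fin.castPred _ h), Fin.castSucc_castPred]
      have h1 : s.partner x.castSucc = Fin.last N ↔ x.castSucc = s.partner (Fin.last N) :=
        ⟨fun e => by rw [← e, s.invol], fun e => by rw [e, s.invol]⟩
      by_cases hx : s.partner x.castSucc = Fin.last N
      · rw [dif_pos hx]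
        exact iff_of_true rfl (Or.inl (h1.1 hx))
      · have h2 := fun e => hx (h1.2 e)
        rw [dif_neg hx, ← Fin.castSucc_inj, Fin.castSucc_castPred]
        exact ⟨Or.inr, fun e => e.resolve_left h2⟩
    rw [e, Finset.card_insert_of_notMem, hcard]
    · simp only [Finset.mem_filter, Finset.mem_univ, true_and, Fin.castSucc_castPred, s.invol]
      exact fun e => h e.symm

theorem cutLast_of_eq (s : LinkState (N + 1) k) (h : s.partner (Fin.last N) ≠ Fin.last N)
    {x : Fin N} (hx : s.partner x.castSucc = Fin.last N) : (s.cutLast h).partner x = x :=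
  dif_pos hx

theorem cutLast_of_ne (s : LinkState (N + 1) k) (h : s.partner (Fin.last N) ≠ Fin.last N)
    {x : Fin N} (hx : s.partner x.castSucc ≠ Fin.last N) :
    ((s.cutLast h).partner x).castSucc = s.partner x.castSucc := by
  simp [cutLast, hx]

theorem castSucc_cutLast (s : LinkState (N + 1) k) (h : s.partner (Fin.last N) ≠ Fin.last N)
    (x : Fin N) : ((s.cutLast h).partner x).castSucc =
      if s.partner x.castSucc = Fin.last N then x.castSucc else s.partner x.castSucc := by
  split_ifs with hx
  · rw [cutLast_of_eq s h hx]
  · exact cutLast_of_ne s h hx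

/-- The site joined to the last one becomes the rightmost through-line. -/
theorem le_of_cutLast_eq (s : LinkState (N + 1) k) (h : s.partner (Fin.last N) ≠ Fin.last N)
    {x : Fin N} (hx : (s.cutLast h).partner x = x) : x.castSucc ≤ s.partner (Fin.last N) := by
  by_contra! hlt
  by_cases h1 : s.partner x.castSucc = Fin.last N
  · rw [← h1, s.invol] at hlt; omega
  · have h2 := cutLast_of_ne s h h1
    rw [hx] at h2
    have h3 := s.uncovered (s.partner (Fin.last N)) x.castSucc hlt
      (by rw [s.invol]; exact Fin.castSucc_lt_last x)
    exact h3 h2.symm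

/-- Cutting loses no information: the former partner of the last site is recovered as the rightmost
through-line. -/
theorem cutLast_injective (s t : LinkState (N + 1) k) (hs : s.partner (Fin.last N) ≠ Fin.last N)
    (ht : t.partner (Fin.last N) ≠ Fin.last N) (h : s.cutLast hs = t.cutLast ht) : s = t := by
  have hfix : ∀ (u : LinkState (N + 1) k) (hu : u.partner (Fin.last N) ≠ Fin.last N),
      (u.cutLast hu).partner ((u.partner (Fin.last N)).castPred hu) =
        (u.partner (Fin.last N)).castPred hu := fun u hu =>
    cutLast_of_eq u hu (by rw [Fin.castSucc_castPred, u.invol])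
  have h1 := le_of_cutLast_eq t ht (h ▸ hfix s hs)
  have h2 := le_of_cutLast_eq s hs (h.symm ▸ hfix t ht)
  rw [Fin.castSucc_castPred] at h1 h2
  have hl : s.partner (Fin.last N) = t.partner (Fin.last N) := le_antisymm h1 h2
  have hiff : ∀ (u : LinkState (N + 1) k) (x : Fin (N + 1)), u.partner x = Fin.last N ↔
      x = u.partner (Fin.last N) := fun u x =>
    ⟨fun e => by rw [← e, u.invol], fun e => by rw [e, u.invol]⟩
  ext1
  funext x
  induction x using Fin.lastCases with
  | last => exact hl
  | cast x =>
    by_cases hx : s.partner x.castSucc = Fin.last N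
    · rw [hx, eq_comm, hiff, ← hl, ← hiff, hx]
    · have hx' : t.partner x.castSucc ≠ Fin.last N := by rwa [Ne, hiff, ← hl, ← hiff]
      rw [← cutLast_of_ne s hs hx, ← cutLast_of_ne t ht hx', h]

/-- Bend the rightmost through-line `a` down to the new last site. Being rightmost, it has no
through-line under the new arc; as a through-line, it lies under no arc of `t`, so nothing crosses.
-/
theorem exists_cutLast (t : LinkState N (k + 1)) :
    ∃ (s : LinkState (N + 1) k) (h : s.partner (Fin.last N) ≠ Fin.last N), s.cutLast h = t := by
  have hne : (Finset.univ.filter fun x => t.partner x = x).Nonempty := by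
    rw [← Finset.card_pos, t.card_through]; omega
  obtain ⟨a, ha, hmax⟩ : ∃ a, t.partner a = a ∧ ∀ x, t.partner x = x → x ≤ a :=
    ⟨Finset.max' _ hne, by simpa using Finset.max'_mem _ hne,
      fun x hx => Finset.le_max' _ x (by simpa using hx)⟩
  let f : Fin (N + 1) → Fin (N + 1) :=
    Fin.lastCases a.castSucc fun x => if x = a then Fin.last N else (t.partner x).castSucc
  have fl : f (Fin.last N) = a.castSucc := by simp [f]
  have fa : f a.castSucc = Fin.last N := by simp [f]
  have fx : ∀ x, x ≠ a → f x.castSucc = (t.partner x).castSucc := fun x hx => by simp [f, hx]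
  have hinj : ∀ x, x ≠ a → t.partner x ≠ a := fun x hx e => hx (by rw [← t.invol x, e, ha])
  have key : ∀ x y, x < y → y < f x → ¬ f x < f y ∧ f y ≠ y := by
    intro x y hxy hy
    induction y using Fin.lastCases with
    | last => simp [Fin.lt_def] at hy; omega
    | cast y =>
      induction x using Fin.lastCases with
      | last => rw [fl] at hy; simp [Fin.lt_def] at hxy; omega
      | cast x =>
        have hxy' : x < y := hxy
        by_cases hxa : x = a
        · subst hxa
          rw [fa, fx y (by omega)]
          refine ⟨by simp [Fin.lt_def], fun e => ?_⟩
          have := hmax y (Fin.castSucc_inj.1 e)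
          omega
        · rw [fx x hxa] at hy ⊢
          have hy' : y < t.partner x := hy
          have hu := t.uncovered x y hxy' hy'
          rw [fx y (fun e => hu (by rw [e, ha]))]
          refine ⟨fun e => t.noncrossing x y hxy' hy' e, fun e => hu (Fin.castSucc_inj.1 e)⟩
  have hal : a.castSucc ≠ Fin.last N := (Fin.castSucc_lt_last a).ne
  refine ⟨⟨f, fun x => ?_, fun x y h1 h2 => (key x y h1 h2).1, fun x y h1 h2 => (key x y h1 h2).2,
    ?_⟩, ?_, ?_⟩
  · induction x using Fin.lastCases with
    | last => rw [fl, fa]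
    | cast x =>
      by_cases hx : x = a
      · rw [hx, fa, fl]
      · rw [fx x hx, fx _ (hinj x hx), t.invol]
  · have hcard := t.card_through
    rw [card_fixed_succ, if_neg (fl ▸ hal), add_zero]
    have e : (Finset.univ.filter fun x : Fin N => f x.castSucc = x.castSucc) =
        (Finset.univ.filter fun x => t.partner x = x).erase a := by
      ext x
      simp only [Finset.mem_filter, Finset.mem_univ, true_and, Finset.mem_erase]
      by_cases hx : x = a
      · subst hx; simpa [fa] using hal.symm
      · simp [fx x hx, hx]
    rw [e, Finset.card_erase_of_mem (by simpa using ha), hcard]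
    omega
  · exact fun e => hal (fl.symm.trans e)
  · ext x : 2
    rw [← Fin.castSucc_inj, castSucc_cutLast]
    by_cases hx : x = a
    · subst hx; simp [fa, ha]
    · simp only [fx x hx, (Fin.castSucc_lt_last _).ne, if_false]

end LinkState

/-! ### Restriction of standard modules -/

theorem TL.intertwine {δ : ℂ} {N : ℕ} {M M' : Type*} [AddCommGroup M] [Module ℂ M]
    [AddCommGroup M'] [Module ℂ M'] {ρ : TL δ N →ₐ[ℂ] Module.End ℂ M}
    {ρ' : TL δ N →ₐ[ℂ] Module.End ℂ M'} {f : M →ₗ[ℂ] M'}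
    (h : ∀ i, i + 1 < N → f ∘ₗ ρ (gen' δ N i) = ρ' (gen' δ N i) ∘ₗ f) (x : TL δ N) :
    f ∘ₗ ρ x = ρ' x ∘ₗ f := by
  induction x using TL.induction with
  | hs c => ext m; simp
  | hg i hi => exact h i hi
  | ha x y hx hy => rw [map_add, map_add, LinearMap.comp_add, LinearMap.add_comp, hx, hy]
  | hm x y hx hy =>
    rw [map_mul, map_mul, Module.End.mul_eq_comp, Module.End.mul_eq_comp, ← LinearMap.comp_assoc,
      hx, LinearMap.comp_assoc, hy, LinearMap.comp_assoc]

theorem stack_map {N N' : ℕ} {j : Fin N → Fin N'} (hj : Function.Injective j) {f : Fin N → Fin N}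
    {f' : Fin N' → Fin N'} (h : ∀ x, f' (j x) = j (f x)) (p q x : Fin N) :
    stack f' (j p) (j q) (j x) = j (stack f p q x) := by
  simp only [stack, h, hj.eq_iff]
  split_ifs <;> rfl

theorem stack_of_notMem_range {N N' : ℕ} {j : Fin N → Fin N'} {f' : Fin N' → Fin N'} {y : Fin N'}
    (hy : ∀ x, j x ≠ y) (hf : ∀ x, j x ≠ f' y) (p q : Fin N) :
    stack f' (j p) (j q) y = f' y := by
  rw [stack, if_neg (hy p).symm, if_neg (hy q).symm, if_neg (hf p).symm, if_neg (hf q).symm]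

namespace Standard

open LinkState

variable {δ : ℂ} {N k : ℕ}

instance : Module.Finite ℂ (Standard δ N k) := Module.Finite.of_basis (basis δ N k)

theorem rep_gen'_basis {i : ℕ} (h : i < N - 1) (s : LinkState N k) :
    rep δ N k (gen' δ N i) (basis δ N k s) = genVec δ ⟨i, h⟩ s := by
  rw [gen'_of_lt δ h, ← smul_def, gen_smul_basis]

/-- A map of link states which is compatible with an inclusion of the sites and does not depend
on the link state outside of its image is compatible with the action of generators. -/
theorem constr_genVec {N' k' : ℕ} (φ : LinkState N k → LinkState N' k') {j : Fin N → Fin N'}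
    (hj : Function.Injective j) (hφ : ∀ s x, (φ s).partner (j x) = j (s.partner x))
    (hout : ∀ y, (∀ x, j x ≠ y) → ∃ z, (∀ x, j x ≠ z) ∧ ∀ s, (φ s).partner y = z)
    {i : Fin (N - 1)} {i' : Fin (N' - 1)} (hf : fstSite i' = j (fstSite i))
    (hs : sndSite i' = j (sndSite i)) (s : LinkState N k) :
    (basis δ N k).constr ℂ (fun t => basis δ N' k' (φ t)) (genVec δ i s) =
      genVec δ i' (φ s) := by
  have hb : (φ s).BothThrough i' ↔ s.BothThrough i := by
    rw [BothThrough, BothThrough, hf, hs, hφ, hφ, hj.eq_iff, hj.eq_iff]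
  by_cases h : s.BothThrough i
  · rw [genVec_of_through h, genVec_of_through (hb.2 h), map_zero]
  · have h' := fun e => h (hb.1 e)
    rw [genVec_of_not h, genVec_of_not h', map_smul, Module.Basis.constr_basis]
    have hw : (φ s).partner (fstSite i') = sndSite i' ↔
        s.partner (fstSite i) = sndSite i := by
      rw [hf, hs, hφ, hj.eq_iff]
    have hc : (φ s).cap i' h' = φ (s.cap i h) := by
      ext y : 2
      change stack (φ s).partner (fstSite i') (sndSite i') y = _
      rw [hf, hs]
      by_cases hy : ∃ x, j x = y
      · obtain ⟨x, rfl⟩ := hy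
        rw [stack_map hj (hφ s), hφ]
        rfl
      · push Not at hy
        obtain ⟨z, hz, hzs⟩ := hout y hy
        rw [stack_of_notMem_range hy (by rwa [hzs]), hzs, hzs]
    rw [hc]
    simp only [hw]

/-- Adding a through-line at the right end. -/
def addThroughMap (δ : ℂ) (N k : ℕ) : Standard δ N k →ₗ[ℂ] Standard δ (N + 1) (k + 1) :=
  (basis δ N k).constr ℂ fun t => basis δ (N + 1) (k + 1) t.addThrough

theorem addThroughMap_rep (x : TL δ N) :
    addThroughMap δ N k ∘ₗ rep δ N k x =
      rep δ (N + 1) (k + 1) (inclLeft δ N 1 x) ∘ₗ addThroughMap δ N k := by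
  refine TL.intertwine (ρ' := (rep δ (N + 1) (k + 1)).comp (inclLeft δ N 1)) (fun i hi => ?_) x
  refine (basis δ N k).ext fun s => ?_
  rw [AlgHom.comp_apply, inclLeft_gen' δ 1 hi, LinearMap.comp_apply, LinearMap.comp_apply,
    rep_gen'_basis (by omega), addThroughMap, Module.Basis.constr_basis,
    rep_gen'_basis (by omega)]
  refine constr_genVec addThrough (Fin.castSucc_injective N)
    (fun s x => addThrough_castSucc s x) (fun y hy => ?_) rfl rfl s
  induction y using Fin.lastCases with
  | last => exact ⟨Fin.last N, fun x => (Fin.castSucc_lt_last x).ne, addThrough_last⟩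
  | cast y => exact absurd rfl (hy y)

/-- Adding an arc at the right end. -/
def addArcMap (δ : ℂ) (N k : ℕ) : Standard δ N k →ₗ[ℂ] Standard δ (N + 2) k :=
  (basis δ N k).constr ℂ fun t => basis δ (N + 2) k t.addArc

theorem addArcMap_rep (x : TL δ N) :
    addArcMap δ N k ∘ₗ rep δ N k x =
      rep δ (N + 2) k (inclLeft δ N 2 x) ∘ₗ addArcMap δ N k := by
  refine TL.intertwine (ρ' := (rep δ (N + 2) k).comp (inclLeft δ N 2)) (fun i hi => ?_) x
  refine (basis δ N k).ext fun s => ?_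
  rw [AlgHom.comp_apply, inclLeft_gen' δ 2 hi, LinearMap.comp_apply, LinearMap.comp_apply,
    rep_gen'_basis (by omega), addArcMap, Module.Basis.constr_basis,
    rep_gen'_basis (by omega)]
  refine constr_genVec addArc (j := fun x => x.castSucc.castSucc)
    ((Fin.castSucc_injective _).comp (Fin.castSucc_injective N))
    (fun s x => addArc_castSucc_castSucc s x) (fun y hy => ?_) rfl rfl s
  induction y using Fin.lastCases with
  | last => exact ⟨(Fin.last N).castSucc, fun x => by simp [Fin.ext_iff]; omega, addArc_last⟩
  | cast y =>
    induction y using Fin.lastCases with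
    | last =>
      exact ⟨Fin.last (N + 1), fun x => (Fin.castSucc_lt_last _).ne, addArc_castSucc_last⟩
    | cast y => exact absurd rfl (hy y)

/-- The last generator factors through adding an arc. -/
theorem exists_addArcMap_comp (δ : ℂ) (N k : ℕ) :
    ∃ r : Standard δ (N + 2) k →ₗ[ℂ] Standard δ N k,
      rep δ (N + 2) k (gen' δ (N + 2) N) = addArcMap δ N k ∘ₗ r ∧
        r ∘ₗ addArcMap δ N k = δ • LinearMap.id := by
  have hlt : N < N + 2 - 1 := by omega
  have hcap : ∀ (s : LinkState (N + 2) k) (h : ¬ s.BothThrough ⟨N, hlt⟩),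
      ∃ t : LinkState N k, t.addArc = s.cap _ h := fun s h =>
    exists_addArc _ (if_pos rfl)
  choose c hc using hcap
  refine ⟨(basis δ (N + 2) k).constr ℂ fun s => if h : s.BothThrough ⟨N, hlt⟩ then 0 else
    (if s.partner (fstSite ⟨N, hlt⟩) = sndSite ⟨N, hlt⟩ then δ else 1) • basis δ N k (c s h),
    (basis δ (N + 2) k).ext fun s => ?_, (basis δ N k).ext fun t => ?_⟩
  · rw [rep_gen'_basis hlt, LinearMap.comp_apply, Module.Basis.constr_basis]
    by_cases h : s.BothThrough ⟨N, hlt⟩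
    · rw [genVec_of_through h, dif_pos h, map_zero]
    · rw [genVec_of_not h, dif_neg h, map_smul, addArcMap, Module.Basis.constr_basis, hc]
  · have hp : t.addArc.partner (fstSite ⟨N, hlt⟩) = sndSite ⟨N, hlt⟩ := addArc_castSucc_last t
    have h : ¬ t.addArc.BothThrough ⟨N, hlt⟩ := fun e => fst_ne_snd _ (e.1.symm.trans hp)
    rw [LinearMap.comp_apply, addArcMap, Module.Basis.constr_basis, Module.Basis.constr_basis,
      dif_neg h, if_pos hp]
    have : c t.addArc h = t := by
      refine addArc_injective ((hc _ h).trans ?_)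
      ext1
      exact stack_of_arc t.addArc.invol hp
    rw [this]
    rfl

/-- Cutting the arc that ends at the last site (zero if there is none). -/
def cutLastMap (δ : ℂ) (N k : ℕ) : Standard δ (N + 1) k →ₗ[ℂ] Standard δ N (k + 1) :=
  (basis δ (N + 1) k).constr ℂ fun s =>
    if h : s.partner (Fin.last N) = Fin.last N then 0 else basis δ N (k + 1) (s.cutLast h)

theorem cutLastMap_of_eq {s : LinkState (N + 1) k} (h : s.partner (Fin.last N) = Fin.last N) :
    cutLastMap δ N k (basis δ (N + 1) k s) = 0 := by
  rw [cutLastMap, Module.Basis.constr_basis, dif_pos h]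

theorem cutLastMap_of_ne {s : LinkState (N + 1) k} (h : s.partner (Fin.last N) ≠ Fin.last N) :
    cutLastMap δ N k (basis δ (N + 1) k s) = basis δ N (k + 1) (s.cutLast h) := by
  rw [cutLastMap, Module.Basis.constr_basis, dif_neg h]

/-- The generator does not touch the last site, so cutting should commute with it. The delicate
point is that cutting can create a through-line and thereby a contraction. -/
theorem cutLastMap_genVec {i : ℕ} (h : i < N - 1) (h' : i < N + 1 - 1) (s : LinkState (N + 1) k) :
    cutLastMap δ N k (genVec δ ⟨i, h'⟩ s) =
      rep δ N (k + 1) (gen' δ N i) (cutLastMap δ N k (basis δ (N + 1) k s)) := by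
  obtain ⟨p, hp⟩ : ∃ p : Fin N, p = fstSite ⟨i, h⟩ := ⟨_, rfl⟩
  obtain ⟨q, hq⟩ : ∃ q : Fin N, q = sndSite ⟨i, h⟩ := ⟨_, rfl⟩
  have hp' : fstSite (N := N + 1) ⟨i, h'⟩ = p.castSucc := by subst hp; rfl
  have hq' : sndSite (N := N + 1) ⟨i, h'⟩ = q.castSucc := by subst hq; rfl
  have hpq : p ≠ q := by subst hp hq; exact fst_ne_snd _
  have hpl : p.castSucc ≠ Fin.last N := (Fin.castSucc_lt_last p).ne
  have hql : q.castSucc ≠ Fin.last N := (Fin.castSucc_lt_last q).ne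
  have hinv := s.invol
  have hcapl : ∀ hb, (s.cap ⟨i, h'⟩ hb).partner (Fin.last N) =
      stack s.partner p.castSucc q.castSucc (Fin.last N) := fun hb => by rw [← hp', ← hq']; rfl
  by_cases hl : s.partner (Fin.last N) = Fin.last N
  · rw [cutLastMap_of_eq hl, map_zero]
    by_cases hb : s.BothThrough ⟨i, h'⟩
    · rw [genVec_of_through hb, map_zero]
    · rw [genVec_of_not hb, map_smul, cutLastMap_of_eq, smul_zero]
      rw [hcapl]
      unfold stack
      grind
  · rw [cutLastMap_of_ne hl, rep_gen'_basis h]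
    have hcut := castSucc_cutLast s hl
    have hbc : (s.cutLast hl).BothThrough ⟨i, h⟩ ↔
        (s.cutLast hl).partner p = p ∧ (s.cutLast hl).partner q = q := by
      rw [hp, hq]; rfl
    have hbs : s.BothThrough ⟨i, h'⟩ ↔
        s.partner p.castSucc = p.castSucc ∧ s.partner q.castSucc = q.castSucc := by
      rw [← hp', ← hq']; rfl
    have hcp := hcut p
    have hcq := hcut q
    by_cases hb : s.BothThrough ⟨i, h'⟩
    · have hb' : (s.cutLast hl).BothThrough ⟨i, h⟩ := by
        rw [hbs] at hb
        rw [hbc, ← Fin.castSucc_inj, ← Fin.castSucc_inj (b := q)]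
        grind
      rw [genVec_of_through hb, genVec_of_through hb', map_zero]
    · rw [genVec_of_not hb, map_smul]
      by_cases hb' : (s.cutLast hl).BothThrough ⟨i, h⟩
      -- Here one of the two sites is joined to the last one and the other carries a through-line.
      -- Stacking moves the through-line to the last site, where cutting gives zero, matching the
      -- contraction on the other side.
      · rw [genVec_of_through hb', cutLastMap_of_eq, smul_zero]
        rw [hcapl]
        rw [hbs] at hb
        rw [hbc, ← Fin.castSucc_inj, ← Fin.castSucc_inj (b := q)] at hb'
        unfold stack
        grind
      · have hlc : (s.cap ⟨i, h'⟩ hb).partner (Fin.last N) ≠ Fin.last N := by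
          rw [hcapl]
          rw [hbs] at hb
          rw [hbc, ← Fin.castSucc_inj, ← Fin.castSucc_inj (b := q)] at hb'
          unfold stack
          grind
        rw [genVec_of_not hb', cutLastMap_of_ne hlc]
        have hw : s.partner (fstSite ⟨i, h'⟩) = sndSite ⟨i, h'⟩ ↔
            (s.cutLast hl).partner (fstSite ⟨i, h⟩) = sndSite ⟨i, h⟩ := by
          rw [hp', hq', ← hp, ← hq, ← Fin.castSucc_inj (b := q)]
          grind
        have hc : (s.cap ⟨i, h'⟩ hb).cutLast hlc = (s.cutLast hl).cap ⟨i, h⟩ hb' := by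
          ext x : 2
          have hcx := hcut x
          have hxl : x.castSucc ≠ Fin.last N := (Fin.castSucc_lt_last x).ne
          have hcapx : (s.cap ⟨i, h'⟩ hb).partner x.castSucc =
            stack s.partner p.castSucc q.castSucc x.castSucc := by rw [← hp', ← hq']; rfl
          have hcapx' : ((s.cutLast hl).cap ⟨i, h⟩ hb').partner x =
            stack (s.cutLast hl).partner p q x := by rw [hp, hq]; rfl
          rw [← Fin.castSucc_inj, castSucc_cutLast, hcapx, hcapx']
          rw [hbs] at hb
          rw [hbc, ← Fin.castSucc_inj, ← Fin.castSucc_inj (b := q)] at hb'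
          have e1 := Fin.castSucc_inj (a := x) (b := p)
          have e2 := Fin.castSucc_inj (a := x) (b := q)
          have e3 := Fin.castSucc_inj (a := (s.cutLast hl).partner x) (b := p)
          have e4 := Fin.castSucc_inj (a := (s.cutLast hl).partner x) (b := q)
          have e5 := Fin.castSucc_inj (a := (s.cutLast hl).partner p) (b := p)
          have e6 := Fin.castSucc_inj (a := (s.cutLast hl).partner q) (b := q)
          have i1 := hinv x.castSucc
          have i2 := hinv p.castSucc
          have i3 := hinv q.castSucc
          have i4 := hinv (Fin.last N)
          -- Moving `castSucc` inside the case distinction turns both sides into expressions over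
          -- the same `Fin (N + 1)`, after which only equational case analysis is left.
          have h3 : (stack (s.cutLast hl).partner p q x).castSucc =
              if x.castSucc = p.castSucc then q.castSucc
              else if x.castSucc = q.castSucc then p.castSucc
              else if ((s.cutLast hl).partner x).castSucc = p.castSucc then
                (if ((s.cutLast hl).partner q).castSucc = q.castSucc then x.castSucc
                  else ((s.cutLast hl).partner q).castSucc)
              else if ((s.cutLast hl).partner x).castSucc = q.castSucc then
                (if ((s.cutLast hl).partner p).castSucc = p.castSucc then x.castSucc
                  else ((s.cutLast hl).partner p).castSucc)
              else ((s.cutLast hl).partner x).castSucc := by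
            simp only [Fin.castSucc_inj, stack]
            split_ifs <;> rfl
          rw [h3]
          clear h3 e1 e2 e3 e4 e5 e6 hcapx hcapx' hcapl hp' hq' hbs hbc hinv
          unfold stack
          generalize ((s.cutLast hl).partner x).castSucc = gx at *
          generalize ((s.cutLast hl).partner p).castSucc = gp at *
          generalize ((s.cutLast hl).partner q).castSucc = gq at *
          grind
        rw [hc]
        simp only [hw]

end Standard

/-! ### Characters of standard modules -/

namespace Standard

open LinkState

variable {δ : ℂ} {N k : ℕ}

theorem cutLastMap_rep (x : TL δ N) :
    cutLastMap δ N k ∘ₗ rep δ (N + 1) k (inclLeft δ N 1 x) =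
      rep δ N (k + 1) x ∘ₗ cutLastMap δ N k := by
  refine TL.intertwine (ρ := (rep δ (N + 1) k).comp (inclLeft δ N 1)) (fun i hi => ?_) x
  refine (basis δ (N + 1) k).ext fun s => ?_
  rw [AlgHom.comp_apply, inclLeft_gen' δ 1 hi, LinearMap.comp_apply, LinearMap.comp_apply,
    rep_gen'_basis (by omega), cutLastMap_genVec (by omega)]

/-- The character of a standard module. -/
def character (δ : ℂ) (N k : ℕ) (x : TL δ N) : ℂ :=
  LinearMap.trace ℂ (Standard δ N k) (rep δ N k x)

theorem character_sub (x y : TL δ N) :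
    character δ N k (x - y) = character δ N k x - character δ N k y := by
  simp [character]

theorem character_smul (c : ℂ) (x : TL δ N) :
    character δ N k (c • x) = c * character δ N k x := by
  simp [character]

theorem character_mul_comm (x y : TL δ N) :
    character δ N k (x * y) = character δ N k (y * x) := by
  rw [character, map_mul, LinearMap.trace_mul_comm, ← map_mul, character]

/-- The last generator is the composite of a retraction `r` and the equivariant map adding an arc.
Cycling the trace moves the computation to `N` sites, where `r` after adding an arc is `δ`. -/
theorem character_inclLeft_mul_gen' (x : TL δ N) :
    character δ (N + 2) k (inclLeft δ N 2 x * gen' δ (N + 2) N) = δ * character δ N k x := by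
  obtain ⟨r, h1, h2⟩ := exists_addArcMap_comp δ N k
  rw [character, map_mul, h1, Module.End.mul_eq_comp, ← LinearMap.comp_assoc, ← addArcMap_rep,
    LinearMap.comp_assoc, LinearMap.trace_comp_comm', LinearMap.comp_assoc, h2,
    LinearMap.comp_smul, LinearMap.comp_id, map_smul, smul_eq_mul, character]

/-- The section is only linear. That suffices, as it serves to split traces and not modules. -/
theorem exists_section (δ : ℂ) (N k : ℕ) :
    ∃ σ : Standard δ N (k + 1) →ₗ[ℂ] Standard δ (N + 1) k,
      cutLastMap δ N k ∘ₗ σ = LinearMap.id ∧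
      ∀ s : LinkState (N + 1) k, s.partner (Fin.last N) ≠ Fin.last N →
        σ (cutLastMap δ N k (basis δ (N + 1) k s)) = basis δ (N + 1) k s := by
  choose j hj hcut using exists_cutLast (N := N) (k := k)
  refine ⟨(basis δ N (k + 1)).constr ℂ fun t => basis δ (N + 1) k (j t),
    (basis δ N (k + 1)).ext fun t => ?_, fun s hs => ?_⟩
  · rw [LinearMap.comp_apply, Module.Basis.constr_basis, cutLastMap_of_ne (hj t), hcut]
    rfl
  · rw [cutLastMap_of_ne hs, Module.Basis.constr_basis,
      cutLast_injective _ _ (hj _) hs (hcut _)]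

/-- Without through-lines the last site always ends an arc, so cutting is bijective. -/
theorem character_inclLeft_one_zero (x : TL δ N) :
    character δ (N + 1) 0 (inclLeft δ N 1 x) = character δ N 1 x := by
  obtain ⟨σ, h1, h2⟩ := exists_section δ N 0
  have hid : σ ∘ₗ cutLastMap δ N 0 = LinearMap.id := by
    refine (basis δ (N + 1) 0).ext fun s => h2 s fun hs => ?_
    have := s.card_through
    rw [Finset.card_eq_zero] at this
    exact Finset.notMem_empty (Fin.last N) (this ▸ by simpa using hs)
  rw [character, ← LinearMap.comp_id (rep δ (N + 1) 0 (inclLeft δ N 1 x)), ← hid,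
    ← LinearMap.comp_assoc, LinearMap.trace_comp_comm', ← LinearMap.comp_assoc, cutLastMap_rep,
    LinearMap.comp_assoc, h1, LinearMap.comp_id, character]

/-- Branching rule: the states whose last site is a through-line span a submodule, the image of
`addThroughMap`, and cutting the last arc identifies the quotient with the standard module with `k +
2` through-lines. The trace is additive along this filtration. -/
theorem character_inclLeft_one_succ (x : TL δ N) :
    character δ (N + 1) (k + 1) (inclLeft δ N 1 x) =
      character δ N k x + character δ N (k + 2) x := by
  classical
  obtain ⟨σ, h1, h2⟩ := exists_section δ N (k + 1)
  choose d hd using exists_addThrough (N := N) (k := k)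
  let ρ : Standard δ (N + 1) (k + 1) →ₗ[ℂ] Standard δ N k :=
    (basis δ (N + 1) (k + 1)).constr ℂ fun s =>
      if h : s.partner (Fin.last N) = Fin.last N then basis δ N k (d s h) else 0
  have hρ : ρ ∘ₗ addThroughMap δ N k = LinearMap.id := by
    refine (basis δ N k).ext fun t => ?_
    rw [LinearMap.comp_apply, addThroughMap, Module.Basis.constr_basis, Module.Basis.constr_basis,
      dif_pos (addThrough_last t), addThrough_injective (hd _ (addThrough_last t))]
    rfl
  have hid : addThroughMap δ N k ∘ₗ ρ + σ ∘ₗ cutLastMap δ N (k + 1) = LinearMap.id := by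
    refine (basis δ (N + 1) (k + 1)).ext fun s => ?_
    rw [LinearMap.add_apply, LinearMap.comp_apply, LinearMap.comp_apply,
      Module.Basis.constr_basis]
    by_cases h : s.partner (Fin.last N) = Fin.last N
    · rw [dif_pos h, cutLastMap_of_eq h, map_zero, add_zero, addThroughMap,
        Module.Basis.constr_basis, hd]
      rfl
    · rw [dif_neg h, h2 s h, map_zero, zero_add]
      rfl
  rw [character, ← LinearMap.comp_id (rep δ (N + 1) (k + 1) (inclLeft δ N 1 x)), ← hid,
    LinearMap.comp_add, map_add]
  congr 1
  · rw [← LinearMap.comp_assoc, ← addThroughMap_rep, LinearMap.comp_assoc,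
      LinearMap.trace_comp_comm', LinearMap.comp_assoc, hρ, LinearMap.comp_id, character]
  · rw [← LinearMap.comp_assoc, LinearMap.trace_comp_comm', ← LinearMap.comp_assoc,
      cutLastMap_rep, LinearMap.comp_assoc, h1, LinearMap.comp_id, character]

theorem character_zero_one (δ : ℂ) (k : ℕ) : character δ 0 k 1 = if k = 0 then 1 else 0 := by
  rw [character, map_one, LinearMap.trace_one, Module.finrank_eq_nat_card_basis (basis δ 0 k)]
  split_ifs with h
  · subst h
    let s : LinkState 0 0 := ⟨id, fun _ => rfl, fun a => a.elim0, fun a => a.elim0, rfl⟩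
    have : Unique (LinkState 0 0) := ⟨⟨s⟩, fun t => LinkState.ext (funext fun a => a.elim0)⟩
    simp
  · have : IsEmpty (LinkState 0 k) := ⟨fun s => h (by rw [← s.card_through]; rfl)⟩
    simp

end Standard

/-! ### Counting multiplicities -/

open Standard

/-- The Clebsch-Gordan rule `k ∈ {|a - b|, |a - b| + 2, …, a + b}`. -/
abbrev Triangle (a b k : ℕ) : Prop := a ≤ b + k ∧ b ≤ a + k ∧ k ≤ a + b ∧ (a + b + k) % 2 = 0

/-- Reading `f n k` as the multiplicity of `k` in `a ⊗ n`, the hypotheses say that `n + 2` is `(n +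
1) ⊗ 1` minus `n`. They determine `f`, and the indicator of `Triangle` satisfies them; `k = 0` is
separate since there is no lower neighbour. -/
theorem clebschGordan_of_recurrence {a : ℕ} {f : ℕ → ℕ → ℂ}
    (h0 : ∀ k, f 0 k = if k = a then 1 else 0) (h10 : f 1 0 = f 0 1)
    (h1 : ∀ k, f 1 (k + 1) = f 0 k + f 0 (k + 2))
    (h20 : ∀ n, f (n + 2) 0 = f (n + 1) 1 - f n 0)
    (h2 : ∀ n k, f (n + 2) (k + 1) = f (n + 1) k + f (n + 1) (k + 2) - f n (k + 1)) (n k : ℕ) :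
    f n k = if Triangle a n k then 1 else 0 := by
  induction n using Nat.twoStepInduction generalizing k with
  | zero => rw [h0]; congr 1; rw [eq_iff_iff]; unfold Triangle; omega
  | one =>
    cases k with
    | zero => rw [h10, h0]; congr 1; rw [eq_iff_iff]; unfold Triangle; omega
    | succ k => rw [h1, h0, h0]; split_ifs <;> first | (norm_num; done) | (exfalso; unfold Triangle at *; omega)
  | more n ih0 ih1 =>
    cases k with
    | zero => rw [h20, ih1, ih0]; split_ifs <;> first | (norm_num; done) | (exfalso; unfold Triangle at *; omega)
    | succ k => rw [h2, ih1, ih1, ih0]; split_ifs <;> first | (norm_num; done) | (exfalso; unfold Triangle at *; omega)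

theorem inclLeft_jonesWenzl_one (δ : ℂ) (n : ℕ) :
    inclLeft δ n 1 (jonesWenzl δ (gen' δ n) n) = jonesWenzl δ (gen' δ (n + 1)) n := by
  rw [map_jonesWenzl]
  exact jonesWenzl_congr fun i hi => inclLeft_gen' δ 1 hi

theorem inclLeft_jonesWenzl_two (δ : ℂ) (n : ℕ) :
    inclLeft δ n 2 (jonesWenzl δ (gen' δ n) n) = jonesWenzl δ (gen' δ (n + 2)) n := by
  rw [map_jonesWenzl]
  exact jonesWenzl_congr fun i hi => inclLeft_gen' δ 2 hi

/-- Apply the character to the Jones-Wenzl recursion. By cyclicity and the partial trace formula the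
correction term becomes the character on two sites fewer, and the two quotients of quantum integers
cancel. -/
theorem character_jonesWenzl_add_two {δ : ℂ} (hδ : δ ≠ 0)
    (hu : ∀ n, 0 < n → quantumNat δ n ≠ 0) (N n k : ℕ) (a : TL δ N) :
    character δ (N + (n + 2)) k
        (inclLeft δ N (n + 2) a * inclRight δ N (n + 2) (jonesWenzl δ (gen' δ (n + 2)) (n + 2))) =
      character δ (N + (n + 1) + 1) k (inclLeft δ (N + (n + 1)) 1 (inclLeft δ N (n + 1) a *
        inclRight δ N (n + 1) (jonesWenzl δ (gen' δ (n + 1)) (n + 1)))) -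
      character δ (N + n) k (inclLeft δ N n a *
        inclRight δ N n (jonesWenzl δ (gen' δ n) n)) := by
  have he := isTLSeq_gen' δ (n + 2)
  have hJ1 := (he.jonesWenzl_props hu (n + 1) (by omega)).1
  have hsand := he.gen_jonesWenzl_gen hu (m := n) (by omega)
  have hsq := he.sq n (by omega)
  have h1 : inclLeft δ (N + (n + 1)) 1 (inclLeft δ N (n + 1) a *
        inclRight δ N (n + 1) (jonesWenzl δ (gen' δ (n + 1)) (n + 1))) =
      inclLeft δ N (n + 2) a * inclRight δ N (n + 2) (jonesWenzl δ (gen' δ (n + 2)) (n + 1)) := by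
    rw [map_mul, inclLeft_inclLeft_one, inclLeft_inclRight_one, inclLeft_jonesWenzl_one]
  have h0 : character δ (N + (n + 2)) k (inclLeft δ N (n + 2) a *
        inclRight δ N (n + 2) (jonesWenzl δ (gen' δ (n + 2)) n * gen' δ (n + 2) n)) =
      δ * character δ (N + n) k (inclLeft δ N n a *
        inclRight δ N n (jonesWenzl δ (gen' δ n) n)) := by
    rw [← character_inclLeft_mul_gen', map_mul (inclLeft δ (N + n) 2), inclLeft_inclLeft_two,
      inclLeft_inclRight_two, inclLeft_jonesWenzl_two, map_mul, inclRight_gen', mul_assoc]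
    rfl
  have hcyc : ∀ x y : TL δ (n + 2),
      character δ (N + (n + 2)) k (inclLeft δ N (n + 2) a * inclRight δ N (n + 2) (x * y)) =
        character δ (N + (n + 2)) k (inclLeft δ N (n + 2) a * inclRight δ N (n + 2) (y * x)) := by
    intro x y
    rw [map_mul, map_mul, ← mul_assoc, character_mul_comm, ← mul_assoc,
      ← (incl_commute δ N (n + 2) a y).eq, mul_assoc]
  have hsm : ∀ (c : ℂ) (x : TL δ (n + 2)),
      character δ (N + (n + 2)) k (inclLeft δ N (n + 2) a * inclRight δ N (n + 2) (c • x)) =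
        c * character δ (N + (n + 2)) k (inclLeft δ N (n + 2) a * inclRight δ N (n + 2) x) := by
    intro c x
    rw [map_smul, mul_smul_comm, character_smul]
  -- The extra factor `δ` allows `δ • e` to be replaced by `e * e`, so that cyclicity produces the
  -- sandwich `e * J * e`.
  have h2 : δ * character δ (N + (n + 2)) k (inclLeft δ N (n + 2) a * inclRight δ N (n + 2)
        (jonesWenzl δ (gen' δ (n + 2)) (n + 1) * gen' δ (n + 2) n *
          jonesWenzl δ (gen' δ (n + 2)) (n + 1))) =
      (quantumNat δ (n + 2) / quantumNat δ (n + 1)) * (δ * character δ (N + n) k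
        (inclLeft δ N n a * inclRight δ N n (jonesWenzl δ (gen' δ n) n))) := by
    rw [hcyc, ← mul_assoc, hJ1, ← h0, ← hsm, ← hsm, ← hsand, mul_assoc, hcyc (gen' δ (n + 2) n),
      mul_assoc, hsq, mul_smul_comm]
  have h3 := mul_left_cancel₀ hδ (h2.trans (mul_left_comm _ _ _))
  have hn1 := hu (n + 1) (by omega)
  have hn2 := hu (n + 2) (by omega)
  rw [h1, jonesWenzl_succ_succ, map_sub, mul_sub, character_sub, hsm, h3, ← mul_assoc]
  rw [div_mul_div_cancel₀ hn2, div_self hn1, one_mul]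
  rfl

/-- The Clebsch-Gordan rule for the character at a Jones-Wenzl projector. -/
theorem character_inclLeft_mul_inclRight_jonesWenzl {δ : ℂ} (hδ : δ ≠ 0)
    (hu : ∀ n, 0 < n → quantumNat δ n ≠ 0) {N j : ℕ} {a : TL δ N}
    (ha : ∀ k, character δ N k a = if k = j then 1 else 0) (n k : ℕ) :
    character δ (N + n) k (inclLeft δ N n a * inclRight δ N n (jonesWenzl δ (gen' δ n) n)) =
      if Triangle j n k then 1 else 0 := by
  have hid : ∀ x : TL δ N, inclLeft δ N 0 x = x := fun x => by
    refine DFunLike.congr_fun (TL.algHom_ext (f := inclLeft δ N 0) (g := AlgHom.id ℂ _)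
      fun i hi => ?_) x
    rw [inclLeft_gen' δ 0 hi]
    rfl
  have h0 : ∀ k, character δ (N + 0) k
      (inclLeft δ N 0 a * inclRight δ N 0 (jonesWenzl δ (gen' δ 0) 0)) = character δ N k a := by
    intro k
    rw [jonesWenzl_zero, map_one, mul_one, hid]
    rfl
  refine clebschGordan_of_recurrence (f := fun n k => character δ (N + n) k
    (inclLeft δ N n a * inclRight δ N n (jonesWenzl δ (gen' δ n) n))) (fun k => ?_) ?_ (fun k => ?_)
    (fun n => ?_) (fun n k => ?_) n k
  · rw [h0, ha]
  · rw [h0, jonesWenzl_one, map_one, mul_one]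
    exact character_inclLeft_one_zero a
  · rw [h0, h0, jonesWenzl_one, map_one, mul_one]
    exact character_inclLeft_one_succ a
  · rw [character_jonesWenzl_add_two hδ hu, character_inclLeft_one_zero]
  · rw [character_jonesWenzl_add_two hδ hu, character_inclLeft_one_succ]

theorem character_jonesWenzl {δ : ℂ} (hδ : δ ≠ 0) (hu : ∀ n, 0 < n → quantumNat δ n ≠ 0)
    (n k : ℕ) : character δ n k (jonesWenzl δ (gen' δ n) n) = if k = n then 1 else 0 := by
  have h := character_inclLeft_mul_inclRight_jonesWenzl hδ hu (N := 0) (j := 0) (a := 1)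
    (character_zero_one δ) n k
  -- Since `0 + n` and `n` are not definitionally equal, the element is first written through its
  -- sequence of generators, where `zero_add` can be rewritten.
  have hr : inclRight δ 0 n (jonesWenzl δ (gen' δ n) n) =
      jonesWenzl δ (fun i => gen' δ (0 + n) (0 + i)) n := by
    rw [map_jonesWenzl]
    simp only [inclRight_gen']
  rw [map_one, one_mul, hr] at h
  have e : (if Triangle 0 n k then (1 : ℂ) else 0) = if k = n then 1 else 0 := by
    congr 1
    rw [eq_iff_iff]
    unfold Triangle
    omega
  simp only [e, zero_add (M := ℕ)] at h
  rwa [zero_add] at h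

/-- The multiplicities of the standard modules in each other. -/
theorem character_proj {δ : ℂ} (hδ : δ ≠ 0) (hu : ∀ n, 0 < n → quantumNat δ n ≠ 0)
    {m j : ℕ} (hj : j ≤ m) (hpar : j ≡ m [MOD 2]) (k : ℕ) :
    character δ m k (proj δ m j) = if k = j then 1 else 0 := by
  induction m using Nat.twoStepInduction with
  | zero =>
    obtain rfl : j = 0 := by omega
    rw [proj_self, character_jonesWenzl hδ hu]
  | one =>
    obtain rfl : j = 1 := by unfold Nat.ModEq at hpar; omega
    rw [proj_self, character_jonesWenzl hδ hu]
  | more m ih _ =>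
    by_cases h : j = m + 2
    · subst h
      rw [proj_self, character_jonesWenzl hδ hu]
    · unfold Nat.ModEq at hpar ih
      rw [proj_of_ne δ h, character_smul, character_inclLeft_mul_gen',
        ih (by omega) (by omega), ← mul_assoc, inv_mul_cancel₀ hδ, one_mul]

/-- The multiplicities of the standard modules of the two factors in the restriction of a standard
module. -/
theorem character_proj_mul_proj {δ : ℂ} (hδ : δ ≠ 0) (hu : ∀ n, 0 < n → quantumNat δ n ≠ 0)
    {N₁ N₂ k₁ k₂ : ℕ} (h₁ : k₁ ≤ N₁) (h₂ : k₂ ≤ N₂) (hpar₁ : k₁ ≡ N₁ [MOD 2])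
    (hpar₂ : k₂ ≡ N₂ [MOD 2]) (k : ℕ) :
    character δ (N₁ + N₂) k
        (inclLeft δ N₁ N₂ (proj δ N₁ k₁) * inclRight δ N₁ N₂ (proj δ N₂ k₂)) =
      if Triangle k₁ k₂ k then 1 else 0 := by
  have hself : ∀ n, character δ (N₁ + n) k
      (inclLeft δ N₁ n (proj δ N₁ k₁) * inclRight δ N₁ n (proj δ n n)) =
      if Triangle k₁ n k then 1 else 0 := fun n => by
    rw [proj_self]
    exact character_inclLeft_mul_inclRight_jonesWenzl hδ hu (character_proj hδ hu h₁ hpar₁) n k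
  induction N₂ using Nat.twoStepInduction with
  | zero =>
    obtain rfl : k₂ = 0 := by omega
    exact hself 0
  | one =>
    obtain rfl : k₂ = 1 := by unfold Nat.ModEq at hpar₂; omega
    exact hself 1
  | more m ih _ =>
    by_cases h : k₂ = m + 2
    · subst h
      exact hself _
    · unfold Nat.ModEq at hpar₂ ih
      rw [← ih (by omega) (by omega), proj_of_ne δ h, map_smul, mul_smul_comm, character_smul,
        map_mul (inclRight δ N₁ (m + 2)), inclRight_gen', ← inclLeft_inclRight_two,
        ← inclLeft_inclLeft_two, ← mul_assoc, ← map_mul]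
      exact (congrArg (δ⁻¹ * ·) (character_inclLeft_mul_gen' _)).trans
        (by rw [← mul_assoc, inv_mul_cancel₀ hδ, one_mul]; rfl)

/-! ### Multiplicities in the fusion -/

open Standard

theorem proj_eq_zero (δ : ℂ) {m j : ℕ} (h : ¬ (j ≤ m ∧ j ≡ m [MOD 2])) : proj δ m j = 0 := by
  induction m using Nat.twoStepInduction with
  | zero => rw [proj, if_neg]; rintro rfl; exact h ⟨le_rfl, rfl⟩
  | one => rw [proj, if_neg]; rintro rfl; exact h ⟨le_rfl, rfl⟩
  | more m ih _ =>
    have hj : j ≠ m + 2 := by rintro rfl; exact h ⟨le_rfl, rfl⟩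
    unfold Nat.ModEq at h ih
    rw [proj_of_ne δ hj, ih (by omega), map_zero, zero_mul, smul_zero]

theorem finrank_range_rep_proj (hδ : δ ≠ 0) (hu : ∀ n, 0 < n → quantumNat δ n ≠ 0) {m j : ℕ}
    (hj : j ≤ m) (hpar : j ≡ m [MOD 2]) (k : ℕ) :
    Module.finrank ℂ (LinearMap.range (rep δ m k (proj δ m j))) = if k = j then 1 else 0 := by
  have h1 := finrank_range_eq_trace (ρ := rep δ m k) (isCellSystem_proj hδ hu m) j
  have h2 := character_proj hδ hu hj hpar k
  rw [character, ← h1] at h2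
  split_ifs at h2 ⊢ <;> exact_mod_cast h2

/-- Vanishing character means rank zero for an idempotent. Thus a standard module has a single
nonzero corner. -/
theorem rep_proj_of_ne (hδ : δ ≠ 0) (hu : ∀ n, 0 < n → quantumNat δ n ≠ 0) {m j k : ℕ}
    (hjk : j ≠ k) : rep δ m k (proj δ m j) = 0 := by
  by_cases h : j ≤ m ∧ j ≡ m [MOD 2]
  · have h1 := finrank_range_rep_proj hδ hu h.1 h.2 k
    rw [if_neg hjk.symm] at h1
    exact LinearMap.range_eq_bot.1 (Submodule.finrank_eq_zero.1 h1)
  · rw [proj_eq_zero δ h, map_zero]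

/-! ### Frobenius reciprocity for fusion -/

section Fusion

variable (δ : ℂ) (N₁ N₂ : ℕ)
  (M₁ : Type*) [AddCommGroup M₁] [Module ℂ M₁] [Module (TL δ N₁) M₁]
  [IsScalarTower ℂ (TL δ N₁) M₁]
  (M₂ : Type*) [AddCommGroup M₂] [Module ℂ M₂] [Module (TL δ N₂) M₂]
  [IsScalarTower ℂ (TL δ N₂) M₂]
  (X : Type*) [AddCommGroup X] [Module ℂ X] [Module (TL δ (N₁ + N₂)) X]
  [IsScalarTower ℂ (TL δ (N₁ + N₂)) X]

/-- The canonical map to the fusion. -/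
def toFusion : M₁ ⊗[ℂ] M₂ →ₗ[ℂ] Fusion δ N₁ N₂ M₁ M₂ :=
  (balancing δ N₁ N₂ M₁ M₂).mkQ.restrictScalars ℂ ∘ₗ
    TensorProduct.mk ℂ (TL δ (N₁ + N₂)) (M₁ ⊗[ℂ] M₂) 1

theorem smul_toFusion (x : TL δ (N₁ + N₂)) (v : M₁ ⊗[ℂ] M₂) :
    x • toFusion δ N₁ N₂ M₁ M₂ v = (balancing δ N₁ N₂ M₁ M₂).mkQ (x ⊗ₜ v) := by
  change x • (balancing δ N₁ N₂ M₁ M₂).mkQ (1 ⊗ₜ v) = _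
  rw [← map_smul, TensorProduct.smul_tmul', smul_eq_mul, mul_one]

theorem toFusion_outerAction (a : TL δ N₁ ⊗[ℂ] TL δ N₂) (v : M₁ ⊗[ℂ] M₂) :
    toFusion δ N₁ N₂ M₁ M₂ (outerAction δ N₁ N₂ M₁ M₂ a v) =
      incl δ N₁ N₂ a • toFusion δ N₁ N₂ M₁ M₂ v := by
  rw [smul_toFusion]
  symm
  refine (Submodule.Quotient.eq _).2 (Submodule.subset_span ⟨1, a, v, ?_⟩)
  rw [one_mul]
  rfl

/-- An intertwiner on the fusion gives an intertwiner on the tensor product. -/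
def fusionIntertwinersMap :
    intertwiners (Algebra.lsmul ℂ ℂ (Fusion δ N₁ N₂ M₁ M₂) : TL δ (N₁ + N₂) →ₐ[ℂ] _)
        (Algebra.lsmul ℂ ℂ X) →ₗ[ℂ]
      intertwiners (outerAction δ N₁ N₂ M₁ M₂)
        ((Algebra.lsmul ℂ ℂ X : TL δ (N₁ + N₂) →ₐ[ℂ] _).comp (incl δ N₁ N₂)) where
  toFun := fun f => ⟨f.1 ∘ₗ toFusion δ N₁ N₂ M₁ M₂, fun a v => by
    rw [LinearMap.comp_apply, toFusion_outerAction]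
    exact f.2 _ _⟩
  map_add' := fun f g => rfl
  map_smul' := fun c f => rfl

/-- Frobenius reciprocity. -/
def fusionIntertwiners :
    intertwiners (Algebra.lsmul ℂ ℂ (Fusion δ N₁ N₂ M₁ M₂) : TL δ (N₁ + N₂) →ₐ[ℂ] _)
        (Algebra.lsmul ℂ ℂ X) ≃ₗ[ℂ]
      intertwiners (outerAction δ N₁ N₂ M₁ M₂)
        ((Algebra.lsmul ℂ ℂ X : TL δ (N₁ + N₂) →ₐ[ℂ] _).comp (incl δ N₁ N₂)) :=
  LinearEquiv.ofBijective (fusionIntertwinersMap δ N₁ N₂ M₁ M₂ X) (by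
    constructor
    · intro f g hfg
      refine Subtype.ext (LinearMap.ext fun z => ?_)
      obtain ⟨t, rfl⟩ := (balancing δ N₁ N₂ M₁ M₂).mkQ_surjective z
      induction t using TensorProduct.induction_on with
      | zero => simp
      | add x y hx hy => rw [map_add, map_add, map_add, hx, hy]
      | tmul x v =>
        have h1 : f.1 (toFusion δ N₁ N₂ M₁ M₂ v) = g.1 (toFusion δ N₁ N₂ M₁ M₂ v) :=
          DFunLike.congr_fun (congrArg Subtype.val hfg) v
        rw [← smul_toFusion]
        exact (f.2 x _).trans ((congrArg (x • ·) h1).trans (g.2 x _).symm)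
    · intro g
      let F : TL δ (N₁ + N₂) ⊗[ℂ] (M₁ ⊗[ℂ] M₂) →ₗ[TL δ (N₁ + N₂)] X :=
        TensorProduct.AlgebraTensorModule.lift
          { toFun := fun x => (Algebra.lsmul ℂ ℂ X x : X →ₗ[ℂ] X) ∘ₗ g.1
            map_add' := fun x y => by rw [map_add, LinearMap.add_comp]
            map_smul' := fun x y => by
              ext v
              simp }
      have hF : ∀ x v, F (x ⊗ₜ v) = x • g.1 v := fun x v => rfl
      have hker : balancing δ N₁ N₂ M₁ M₂ ≤ LinearMap.ker F := by
        refine Submodule.span_le.2 ?_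
        rintro _ ⟨x, a, v, rfl⟩
        have h1 : g.1 (outerAction δ N₁ N₂ M₁ M₂ a v) = incl δ N₁ N₂ a • g.1 v := g.2 a v
        rw [SetLike.mem_coe, LinearMap.mem_ker, map_sub, hF, hF, h1, mul_smul, sub_self]
      let G := (balancing δ N₁ N₂ M₁ M₂).liftQ F hker
      refine ⟨⟨G.restrictScalars ℂ, fun a m => G.map_smul a m⟩, Subtype.ext ?_⟩
      ext v w
      change F (1 ⊗ₜ (v ⊗ₜ w)) = _
      rw [hF, one_smul]
      rfl)

end Fusion

/-! ### Dimensions of the corners of the fusion -/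

theorem outerAction_proj_of_ne {δ : ℂ} (hδ : δ ≠ 0) (hu : ∀ n, 0 < n → quantumNat δ n ≠ 0)
    {N₁ N₂ k₁ k₂ : ℕ} {p : ℕ × ℕ} (hp : p ≠ (k₁, k₂)) :
    outerAction δ N₁ N₂ (Standard δ N₁ k₁) (Standard δ N₂ k₂)
      (proj δ N₁ p.1 ⊗ₜ proj δ N₂ p.2) = 0 := by
  have h : outerAction δ N₁ N₂ (Standard δ N₁ k₁) (Standard δ N₂ k₂)
      (proj δ N₁ p.1 ⊗ₜ proj δ N₂ p.2) =
      TensorProduct.map (rep δ N₁ k₁ (proj δ N₁ p.1)) (rep δ N₂ k₂ (proj δ N₂ p.2)) := rfl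
  rw [h]
  by_cases h1 : p.1 = k₁
  · rw [rep_proj_of_ne hδ hu (fun h2 => hp (Prod.ext h1 h2)), TensorProduct.map_zero_right]
  · rw [rep_proj_of_ne hδ hu h1, TensorProduct.map_zero_left]

theorem finrank_range_outerAction {δ : ℂ} (hδ : δ ≠ 0) (hu : ∀ n, 0 < n → quantumNat δ n ≠ 0)
    {N₁ N₂ k₁ k₂ : ℕ} (h₁ : k₁ ≤ N₁) (h₂ : k₂ ≤ N₂)
    (hpar₁ : k₁ ≡ N₁ [MOD 2]) (hpar₂ : k₂ ≡ N₂ [MOD 2]) :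
    Module.finrank ℂ (LinearMap.range (outerAction δ N₁ N₂ (Standard δ N₁ k₁) (Standard δ N₂ k₂)
      (proj δ N₁ k₁ ⊗ₜ proj δ N₂ k₂))) = 1 := by
  have h1 := finrank_range_eq_trace
    (ρ := outerAction δ N₁ N₂ (Standard δ N₁ k₁) (Standard δ N₂ k₂))
    ((isCellSystem_proj hδ hu N₁).tensor (isCellSystem_proj hδ hu N₂)) (k₁, k₂)
  have h2 := character_proj hδ hu h₁ hpar₁ k₁
  have h3 := character_proj hδ hu h₂ hpar₂ k₂
  have h4 := LinearMap.trace_tensorProduct' (rep δ N₁ k₁ (proj δ N₁ k₁))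
    (rep δ N₂ k₂ (proj δ N₂ k₂))
  rw [if_pos rfl, character] at h2 h3
  rw [h2, h3, one_mul] at h4
  exact_mod_cast h1.trans h4

theorem finrank_range_rep_incl {δ : ℂ} (hδ : δ ≠ 0) (hu : ∀ n, 0 < n → quantumNat δ n ≠ 0)
    {N₁ N₂ k₁ k₂ : ℕ} (h₁ : k₁ ≤ N₁) (h₂ : k₂ ≤ N₂)
    (hpar₁ : k₁ ≡ N₁ [MOD 2]) (hpar₂ : k₂ ≡ N₂ [MOD 2]) (k : ℕ) :
    Module.finrank ℂ (LinearMap.range (((Algebra.lsmul ℂ ℂ (Standard δ (N₁ + N₂) k) :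
      TL δ (N₁ + N₂) →ₐ[ℂ] _).comp (incl δ N₁ N₂)) (proj δ N₁ k₁ ⊗ₜ proj δ N₂ k₂))) =
      if Triangle k₁ k₂ k then 1 else 0 := by
  have h1 := finrank_range_eq_trace
    (ρ := (Algebra.lsmul ℂ ℂ (Standard δ (N₁ + N₂) k) :
      TL δ (N₁ + N₂) →ₐ[ℂ] _).comp (incl δ N₁ N₂))
    ((isCellSystem_proj hδ hu N₁).tensor (isCellSystem_proj hδ hu N₂)) (k₁, k₂)
  have h2 := character_proj_mul_proj hδ hu h₁ h₂ hpar₁ hpar₂ k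
  have h3 : incl δ N₁ N₂ (proj δ N₁ k₁ ⊗ₜ proj δ N₂ k₂) =
      inclLeft δ N₁ N₂ (proj δ N₁ k₁) * inclRight δ N₁ N₂ (proj δ N₂ k₂) :=
    Algebra.TensorProduct.lift_tmul ..
  have h4 := h1.trans (congrArg (fun z => LinearMap.trace ℂ (Standard δ (N₁ + N₂) k)
    (rep δ (N₁ + N₂) k z)) h3)
  rw [character] at h2
  rw [h2] at h4
  split_ifs at h4 ⊢ <;> exact_mod_cast h4

/-- The corner is measured by intertwiners into the standard module `k`. Frobenius reciprocity
converts these into intertwiners out of the tensor product, which has the single nonzero corner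
`(k₁, k₂)`, a line. -/
theorem finrank_range_fusion {δ : ℂ} (hδ : δ ≠ 0) (hu : ∀ n, 0 < n → quantumNat δ n ≠ 0)
    {N₁ N₂ k₁ k₂ : ℕ} (h₁ : k₁ ≤ N₁) (h₂ : k₂ ≤ N₂)
    (hpar₁ : k₁ ≡ N₁ [MOD 2]) (hpar₂ : k₂ ≡ N₂ [MOD 2]) {k : ℕ} (hk : k ≤ N₁ + N₂)
    (hpar : k ≡ N₁ + N₂ [MOD 2]) :
    Module.Finite ℂ (LinearMap.range ((Algebra.lsmul ℂ ℂ (Fusion δ N₁ N₂ (Standard δ N₁ k₁)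
      (Standard δ N₂ k₂)) : TL δ (N₁ + N₂) →ₐ[ℂ] _) (proj δ (N₁ + N₂) k))) ∧
    Module.finrank ℂ (LinearMap.range ((Algebra.lsmul ℂ ℂ (Fusion δ N₁ N₂ (Standard δ N₁ k₁)
      (Standard δ N₂ k₂)) : TL δ (N₁ + N₂) →ₐ[ℂ] _) (proj δ (N₁ + N₂) k))) =
      if Triangle k₁ k₂ k then 1 else 0 := by
  have hrep : ∀ j, (Algebra.lsmul ℂ ℂ (Standard δ (N₁ + N₂) k) :
      TL δ (N₁ + N₂) →ₐ[ℂ] _) (proj δ (N₁ + N₂) j) =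
        rep δ (N₁ + N₂) k (proj δ (N₁ + N₂) j) := fun j => rfl
  have e1 := (isCellSystem_proj hδ hu (N₁ + N₂)).intertwinersEquiv
    (Algebra.lsmul ℂ ℂ (Fusion δ N₁ N₂ (Standard δ N₁ k₁) (Standard δ N₂ k₂)))
    (Algebra.lsmul ℂ ℂ (Standard δ (N₁ + N₂) k)) k (fun j hj => by
      rw [hrep, rep_proj_of_ne hδ hu hj, LinearMap.range_zero]
      infer_instance)
  have e2 := fusionIntertwiners δ N₁ N₂ (Standard δ N₁ k₁) (Standard δ N₂ k₂)
    (Standard δ (N₁ + N₂) k)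
  have e3 := ((isCellSystem_proj hδ hu N₁).tensor (isCellSystem_proj hδ hu N₂)).intertwinersEquiv
    (outerAction δ N₁ N₂ (Standard δ N₁ k₁) (Standard δ N₂ k₂))
    ((Algebra.lsmul ℂ ℂ (Standard δ (N₁ + N₂) k) : TL δ (N₁ + N₂) →ₐ[ℂ] _).comp (incl δ N₁ N₂))
    (k₁, k₂) (fun p hp => by
      rw [outerAction_proj_of_ne hδ hu hp, LinearMap.range_zero]
      infer_instance)
  have hdim : Module.finrank ℂ (LinearMap.range ((Algebra.lsmul ℂ ℂ (Standard δ (N₁ + N₂) k) :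
      TL δ (N₁ + N₂) →ₐ[ℂ] _) (proj δ (N₁ + N₂) k))) = Module.finrank ℂ ℂ := by
    rw [hrep, finrank_range_rep_proj hδ hu hk hpar, if_pos rfl, Module.finrank_self]
  have e4 := LinearEquiv.ofFinrankEq _ _ hdim
  -- Identifying the one-dimensional corner of the target with `ℂ` turns the maps from the corner of
  -- the fusion into its dual.
  have e5 := ((e1.symm.trans (e2.trans e3)).symm.trans
    ((LinearEquiv.refl ℂ _).arrowCongr e4))
  -- Finite dimension of this corner is not known beforehand; it follows from that of its dual.
  have hfin : Module.Finite ℂ (LinearMap.range ((Algebra.lsmul ℂ ℂ (Fusion δ N₁ N₂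
      (Standard δ N₁ k₁) (Standard δ N₂ k₂)) : TL δ (N₁ + N₂) →ₐ[ℂ] _)
        (proj δ (N₁ + N₂) k))) :=
    (Module.finite_dual_iff ℂ).1 (Module.Finite.equiv e5)
  refine ⟨hfin, ?_⟩
  rw [← Subspace.dual_finrank_eq]
  refine e5.finrank_eq.symm.trans ?_
  rw [Module.finrank_linearMap, finrank_range_outerAction hδ hu h₁ h₂ hpar₁ hpar₂, one_mul,
    finrank_range_rep_incl hδ hu h₁ h₂ hpar₁ hpar₂]

/-- The corners of a direct sum of pairwise different standard modules. -/
theorem nonempty_range_directSum_equiv {δ : ℂ} (hδ : δ ≠ 0)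
    (hu : ∀ n, 0 < n → quantumNat δ n ≠ 0) {N : ℕ} {p : ℕ → Prop} {j : ℕ} :
    (p j → Nonempty (LinearMap.range (rep δ N j (proj δ N j)) ≃ₗ[ℂ]
      LinearMap.range ((Algebra.lsmul ℂ ℂ (⨁ k : {k : ℕ // p k}, Standard δ N k) :
        TL δ N →ₐ[ℂ] _) (proj δ N j)))) ∧
    (¬ p j → (Algebra.lsmul ℂ ℂ (⨁ k : {k : ℕ // p k}, Standard δ N k) :
        TL δ N →ₐ[ℂ] _) (proj δ N j) = 0) := by
  classical
  -- Only the summand of index `j` survives, because the idempotent acts as zero on all others.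
  have hz : ∀ (c : ⨁ k : {k : ℕ // p k}, Standard δ N k) (i : {k : ℕ // p k}), j ≠ i →
      (proj δ N j • c) i = 0 := fun c i hi => by
    rw [DirectSum.smul_apply, smul_def, rep_proj_of_ne hδ hu hi, LinearMap.zero_apply]
  constructor
  · intro h
    have hc : ∀ c : ⨁ k : {k : ℕ // p k}, Standard δ N k, proj δ N j • c =
        DirectSum.lof ℂ {k : ℕ // p k} (fun k => Standard δ N k) ⟨j, h⟩
          (rep δ N j (proj δ N j) (c ⟨j, h⟩)) := by
      intro c
      refine DFinsupp.ext fun i => ?_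
      by_cases hi : i = ⟨j, h⟩
      · subst hi
        rw [DirectSum.lof_apply]
        exact DirectSum.smul_apply _ _ _
      · refine (hz c i fun e => hi (Subtype.ext e.symm)).trans ?_
        rw [DirectSum.lof_eq_of, DirectSum.of_eq_of_ne _ _ _ hi]
    have hrange : LinearMap.range ((Algebra.lsmul ℂ ℂ (⨁ k : {k : ℕ // p k}, Standard δ N k) :
        TL δ N →ₐ[ℂ] _) (proj δ N j)) =
        (LinearMap.range (rep δ N j (proj δ N j))).map
          (DirectSum.lof ℂ {k : ℕ // p k} (fun k => Standard δ N k) ⟨j, h⟩) := by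
      ext z
      constructor
      · rintro ⟨c, rfl⟩
        exact ⟨_, ⟨c ⟨j, h⟩, rfl⟩, (hc c).symm⟩
      · rintro ⟨_, ⟨w, rfl⟩, rfl⟩
        refine ⟨DirectSum.lof ℂ {k : ℕ // p k} (fun k => Standard δ N k) ⟨j, h⟩ w, ?_⟩
        refine (hc _).trans ?_
        rw [DirectSum.lof_apply]
    rw [hrange]
    exact ⟨Submodule.equivMapOfInjective _ (DirectSum.of_injective (β := fun k : {k : ℕ // p k} => Standard δ N k) ⟨j, h⟩) _⟩
  · intro h
    refine LinearMap.ext fun c => ?_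
    exact DFinsupp.ext fun i => hz c i fun e => h (e ▸ i.2)

end TemperleyLieb

/-! ### The fusion rule, by comparison of corners -/

theorem mainTheorem5 (q : ℂ) (hq₀ : q ≠ 0) (hq : ∀ n : ℕ, 0 < n → q ^ n ≠ 1)
    (N₁ N₂ k₁ k₂ : ℕ) (h₁ : k₁ ≤ N₁) (h₂ : k₂ ≤ N₂)
    (hpar₁ : k₁ ≡ N₁ [MOD 2]) (hpar₂ : k₂ ≡ N₂ [MOD 2]) :
    Nonempty
      (TemperleyLieb.Fusion (q + q⁻¹) N₁ N₂
          (TemperleyLieb.Standard (q + q⁻¹) N₁ k₁) (TemperleyLieb.Standard (q + q⁻¹) N₂ k₂)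
        ≃ₗ[TemperleyLieb.TL (q + q⁻¹) (N₁ + N₂)]
        ⨁ k : {k : ℕ // |(k₁ : ℤ) - k₂| ≤ k ∧ k ≤ k₁ + k₂ ∧ k ≡ k₁ + k₂ [MOD 2]},
          TemperleyLieb.Standard (q + q⁻¹) (N₁ + N₂) k) := by
  open TemperleyLieb in
  have hu : ∀ n, 0 < n → quantumNat (q + q⁻¹) n ≠ 0 := fun n hn => quantumNat_ne_zero hq₀ hq hn
  -- The loop fugacity is the quantum integer of index `2`.
  have hδ : q + q⁻¹ ≠ 0 := by simpa [quantumNat] using hu 2 (by omega)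
  set δ := q + q⁻¹
  have htri : ∀ k : ℕ, (|(k₁ : ℤ) - k₂| ≤ k ∧ k ≤ k₁ + k₂ ∧ k ≡ k₁ + k₂ [MOD 2]) ↔
      Triangle k₁ k₂ k := by
    intro k
    unfold Triangle Nat.ModEq
    rw [abs_le]
    omega
  have hθ : ∀ k, Nonempty (LinearMap.range ((Algebra.lsmul ℂ ℂ (Fusion δ N₁ N₂ (Standard δ N₁ k₁)
      (Standard δ N₂ k₂)) : TL δ (N₁ + N₂) →ₐ[ℂ] _) (proj δ (N₁ + N₂) k)) ≃ₗ[ℂ]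
      LinearMap.range ((Algebra.lsmul ℂ ℂ (⨁ k : {k : ℕ // |(k₁ : ℤ) - k₂| ≤ k ∧ k ≤ k₁ + k₂ ∧
        k ≡ k₁ + k₂ [MOD 2]}, Standard δ (N₁ + N₂) k) : TL δ (N₁ + N₂) →ₐ[ℂ] _)
          (proj δ (N₁ + N₂) k))) := by
    intro k
    by_cases hk : k ≤ N₁ + N₂ ∧ k ≡ N₁ + N₂ [MOD 2]
    · obtain ⟨hfin, hrank⟩ := finrank_range_fusion hδ hu h₁ h₂ hpar₁ hpar₂ hk.1 hk.2
      obtain ⟨hpos, hneg⟩ := nonempty_range_directSum_equiv hδ hu (N := N₁ + N₂)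
        (p := fun k : ℕ => |(k₁ : ℤ) - k₂| ≤ k ∧ k ≤ k₁ + k₂ ∧ k ≡ k₁ + k₂ [MOD 2]) (j := k)
      by_cases ht : Triangle k₁ k₂ k
      · obtain ⟨e⟩ := hpos ((htri k).2 ht)
        rw [if_pos ht] at hrank
        have h := finrank_range_rep_proj hδ hu hk.1 hk.2 k
        rw [if_pos rfl] at h
        exact ⟨(LinearEquiv.ofFinrankEq _ _ (hrank.trans h.symm)).trans e⟩
      -- Rank zero forces a trivial corner only because `hfin` excludes infinite dimension.
      · rw [if_neg ht] at hrank
        rw [hneg fun h => ht ((htri k).1 h), Submodule.finrank_eq_zero.1 hrank,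
          LinearMap.range_zero]
        exact ⟨(LinearEquiv.ofSubsingleton _ _)⟩
    -- For an inadmissible number of through-lines the idempotent itself is zero, so both corners
    -- vanish.
    · rw [proj_eq_zero δ hk, map_zero, map_zero, LinearMap.range_zero, LinearMap.range_zero]
      exact ⟨(LinearEquiv.ofSubsingleton _ _)⟩
  obtain ⟨f, hf⟩ := (isCellSystem_proj hδ hu (N₁ + N₂)).exists_equiv fun k => (hθ k).some
  exact ⟨{ f with map_smul' := hf }⟩

end
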